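/- Planar trees are rooted plane trees $T$, finite or infinite, in which every vertex has finitely many (ordered) offspring and the root has exactly one offspring. Let $D_r(T)$ be the set of vertices at distance $r$ from the root, $h(T)$ the height and $|T|$ the number of edges of $T$, and $B_r(T)$ the subtree spanned by the vertices at distance at most $r$ from the root. Let $\mathcal T$ be the space of planar trees, with the metric $\mathrm{dist}(T,T')=\inf\{1/r : r\in\mathbb N,\ B_r(T)=B_r(T')\}$ (with $\mathbb N=\{1,2,\dots\}$), closed balls $\mathcal B_a(T)$, and its Borel $\sigma$-algebra. For $\mu\in\mathbb R$ and $N\ge 1$ let $\nu^{(\mu)}_N$ be the probability measure on $\mathcal T$ supported on the trees of size $|T|=N$ with $\nu^{(\mu)}_N(\{T\})=e^{-\mu h(T)}/Z^{(\mu)}_N$, where $Z^{(\mu)}_N=\sum_{|T|=N}e^{-\mu h(T)}$. Let $X(g)=\sum_{T\ \mathrm{finite}}g^{|T|}$ and $g_c(k)=k/(1+k)^2$. For a subcritical offspring distribution $p$ on $\{0,1,2,\dots\}$ with mean $m=\sum_n n\,p(n)$, put $p^*(n)=(n+1)p(n+1)/m$ and $p^s(n)=p^*(n)/(n+1)=p(n+1)/m$.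 The associated Kesten (size-biased) BGW tree is the Borel probability measure $\hat\lambda$ on $\mathcal T$, supported on infinite trees, such that for every finite tree $T_0$, with $r=h(T_0)$, $$\hat\lambda\big(\mathcal B_{1/r}(T_0)\big)=\sum_{i\in D_r(T_0)}\ \prod_{v}p(\sigma(v)-1)\ \prod_{w}p^s(\sigma(w)-2),$$ where $\sigma$ denotes the degree in $T_0$, $w$ runs over the vertices at heights $1,\dots,r-1$ on the path from the root to $i$, and $v$ runs over the other vertices at heights $1,\dots,r-1$. **Proposition.** Let $\mu<0$ and $k=e^{-\mu}>1$. Then the series $X(g_c(k))$ converges, and $$p(n)=X(g_c(k))^n\,\big(1-X(g_c(k))\big),\qquad n=0,1,2,\dots,$$ is a probability distribution with mean less than $1$. The measures $\nu^{(\mu)}_N$ converge weakly, as $N\to\infty$, to a Borel probability measure $\nu^{(\mu)}$ on $\mathcal T$, and $\nu^{(\mu)}$ equals the measure $\hat\lambda$ associated to $p$, which exists and is unique. Moreover, $\nu^{(\mu)}$-almost every tree has a single spine: at each height it has exactly one vertex with infinitely many descendants. -/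

import Mathlib

open MeasureTheory Filter Topology

noncomputable section

/-- A rooted planar tree, given by its set of vertices in Ulam--Harris notation. A vertex is the
finite word that records the positions (from the left, counted from `0`) of its ancestors among
their siblings; the parent of `u ++ [i]` is `u`, and the offspring of `u` is ordered by `i`.
The root `[]` has exactly one offspring `[0]`, and every vertex has finitely many offspring. -/
@[ext] structure PlaneTree where
  carrier : Set (List ℕ)
  nil_mem : [] ∈ carrier
  root_edge : ∀ j, [j] ∈ carrier ↔ j = 0
  parent_mem : ∀ u i, u ++ [i] ∈ carrier → u ∈ carrier
  left_sibling_mem : ∀ u i j, j ≤ i → u ++ [i] ∈ carrier → u ++ [j] ∈ carrier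
  offspring_finite : ∀ u, {i | u ++ [i] ∈ carrier}.Finite

namespace PlaneTree

/-- The set `D_r` of vertices at height `r`. -/
def level (T : PlaneTree) (r : ℕ) : Set (List ℕ) := {u | u ∈ T.carrier ∧ u.length = r}

/-- The set of vertices of the ball `B_r(T)` around the root. In Ulam--Harris notation a subtree
containing the root is determined by its set of vertices. -/
def ballVerts (T : PlaneTree) (r : ℕ) : Set (List ℕ) := {u | u ∈ T.carrier ∧ u.length ≤ r}

/-- The number of offspring of `v`, that is, the degree `σ(v)` minus one if `v` is a vertex
different from the root. -/
def offspring (T : PlaneTree) (v : List ℕ) : ℕ := {i | v ++ [i] ∈ T.carrier}.ncard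

/-- The tree has finitely many vertices. -/
def IsFinite (T : PlaneTree) : Prop := T.carrier.Finite

/-- The size `|T|` of a finite tree: its number of edges. Each edge joins a vertex different from
the root to the parent of that vertex. -/
def size (T : PlaneTree) : ℕ := (T.carrier \ {[]}).ncard

/-- The height of a finite tree: the largest `r` such that `D_r` is not empty. -/
def height (T : PlaneTree) : ℕ := sSup {r | (T.level r).Nonempty}

/-- The vertex `u` of `T` is of infinite type: it has infinitely many descendants. -/
def IsInfiniteType (T : PlaneTree) (u : List ℕ) : Prop :=
  {w | w ∈ T.carrier ∧ u <+: w}.Infinite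

/-- The tree has a single spine: its vertices of infinite type form one infinite path from the
root, that is, there is exactly one of them at each height. -/
def HasSingleSpine (T : PlaneTree) : Prop :=
  ∀ r, ∃! u, u ∈ T.level r ∧ T.IsInfiniteType u

theorem level_finite (T : PlaneTree) (r : ℕ) : (T.level r).Finite := by
  induction r with
  | zero =>
    refine (Set.finite_singleton ([] : List ℕ)).subset ?_
    rintro u ⟨-, hu⟩
    simpa using hu
  | succ r ih =>
    refine (ih.biUnion (fun u _ => (T.offspring_finite u).image (fun i => u ++ [i]))).subset ?_
    rintro w ⟨hw, hl⟩
    rcases List.eq_nil_or_concat' w with rfl | ⟨u, i, rfl⟩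
    · simp at hl
    · have hl' : u.length = r := by simpa using hl
      simp only [Set.mem_iUnion]
      exact ⟨u, ⟨T.parent_mem u i hw, hl'⟩, i, hw, rfl⟩

/-- The set `D_r` as a `Finset`. -/
def levelFinset (T : PlaneTree) (r : ℕ) : Finset (List ℕ) := (T.level_finite r).toFinset

/-- The vertices at heights `1, …, r - 1`, as a `Finset`. -/
def innerVerts (T : PlaneTree) (r : ℕ) : Finset (List ℕ) :=
  (Finset.Ico 1 r).biUnion T.levelFinset

/-! ### The metric -/

/-- The radii `1 / r` of the balls around the root that two trees have in common. -/
def commonRadii (T T' : PlaneTree) : Set ℝ :=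
  {a | ∃ r : ℕ, 1 ≤ r ∧ T.ballVerts r = T'.ballVerts r ∧ a = 1 / (r : ℝ)}

theorem ballVerts_one (T : PlaneTree) : T.ballVerts 1 = {[], [0]} := by
  ext u
  simp only [ballVerts, Set.mem_ofPred_eq, Set.mem_insert_iff, Set.mem_singleton_iff]
  constructor
  · rintro ⟨hu, hl⟩
    match u, hu, hl with
    | [], _, _ => exact Or.inl rfl
    | [j], hu, _ => exact Or.inr (by rw [(T.root_edge j).1 hu])
    | _ :: _ :: _, _, hl => simp at hl
  · rintro (rfl | rfl)
    · exact ⟨T.nil_mem, by simp⟩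
    · exact ⟨(T.root_edge 0).2 rfl, by simp⟩

theorem ballVerts_mono_eq {T T' : PlaneTree} {r s : ℕ} (h : T.ballVerts s = T'.ballVerts s)
    (hrs : r ≤ s) : T.ballVerts r = T'.ballVerts r := by
  ext u
  have hu := Set.ext_iff.1 h u
  simp only [ballVerts, Set.mem_ofPred_eq] at hu ⊢
  constructor
  · rintro ⟨h1, h2⟩
    exact ⟨(hu.1 ⟨h1, h2.trans hrs⟩).1, h2⟩
  · rintro ⟨h1, h2⟩
    exact ⟨(hu.2 ⟨h1, h2.trans hrs⟩).1, h2⟩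

theorem commonRadii_nonempty (T T' : PlaneTree) : (commonRadii T T').Nonempty :=
  ⟨1 / ((1 : ℕ) : ℝ), 1, le_rfl, by rw [ballVerts_one, ballVerts_one], rfl⟩

theorem commonRadii_nonneg (T T' : PlaneTree) : ∀ a ∈ commonRadii T T', 0 ≤ a := by
  rintro a ⟨r, -, -, rfl⟩
  positivity

theorem commonRadii_bddBelow (T T' : PlaneTree) : BddBelow (commonRadii T T') :=
  ⟨0, fun a ha => commonRadii_nonneg T T' a ha⟩

/-- The distance `dist(T, T') = inf {1 / r | B_r(T) = B_r(T')}`. -/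
instance : Dist PlaneTree := ⟨fun T T' => sInf (commonRadii T T')⟩

theorem dist_def (T T' : PlaneTree) : dist T T' = sInf (commonRadii T T') := rfl

theorem dist_self' (T : PlaneTree) : dist T T = 0 := by
  refine le_antisymm ?_ (le_csInf (commonRadii_nonempty T T) (commonRadii_nonneg T T))
  refine le_of_forall_pos_le_add fun ε hε => ?_
  obtain ⟨n, hn⟩ := exists_nat_one_div_lt hε
  have h : dist T T ≤ 1 / ((n + 1 : ℕ) : ℝ) :=
    csInf_le (commonRadii_bddBelow T T) ⟨n + 1, by omega, rfl, rfl⟩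
  push_cast at h
  linarith

theorem dist_comm' (T T' : PlaneTree) : dist T T' = dist T' T := by
  have : commonRadii T T' = commonRadii T' T := by
    ext a
    simp only [commonRadii, Set.mem_ofPred_eq, eq_comm]
  rw [dist_def, dist_def, this]

theorem dist_triangle' (T T' T'' : PlaneTree) : dist T T'' ≤ dist T T' + dist T' T'' := by
  refine le_of_forall_pos_lt_add fun ε hε => ?_
  obtain ⟨a, ⟨r, hr, hrT, rfl⟩, ha⟩ :=
    exists_lt_of_csInf_lt (commonRadii_nonempty T T') (lt_add_of_pos_right _ (half_pos hε))
  obtain ⟨b, ⟨s, hs, hsT, rfl⟩, hb⟩ :=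
    exists_lt_of_csInf_lt (commonRadii_nonempty T' T'') (lt_add_of_pos_right _ (half_pos hε))
  rw [← dist_def] at ha hb
  have hr0 : (0 : ℝ) < 1 / (r : ℝ) := by positivity
  have hs0 : (0 : ℝ) < 1 / (s : ℝ) := by positivity
  rcases le_total r s with h | h
  · have : dist T T'' ≤ 1 / (r : ℝ) :=
      csInf_le (commonRadii_bddBelow T T'') ⟨r, hr, hrT.trans (ballVerts_mono_eq hsT h), rfl⟩
    linarith
  · have : dist T T'' ≤ 1 / (s : ℝ) :=
      csInf_le (commonRadii_bddBelow T T'') ⟨s, hs, (ballVerts_mono_eq hrT h).trans hsT, rfl⟩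
    linarith

theorem ballVerts_eq_of_dist_lt {T T' : PlaneTree} {n : ℕ} (hn : 1 ≤ n)
    (h : dist T T' < 1 / (n : ℝ)) : T.ballVerts n = T'.ballVerts n := by
  obtain ⟨a, ⟨r, hr, hrT, rfl⟩, ha⟩ := exists_lt_of_csInf_lt (commonRadii_nonempty T T') h
  refine ballVerts_mono_eq hrT ?_
  have hr0 : (0 : ℝ) < r := by exact_mod_cast hr
  have hn0 : (0 : ℝ) < n := by exact_mod_cast hn
  have := (one_div_lt_one_div hr0 hn0).1 ha
  exact_mod_cast this.le

theorem eq_of_dist_eq_zero' {T T' : PlaneTree} (h : dist T T' = 0) : T = T' := by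
  have key : ∀ n : ℕ, T.ballVerts (n + 1) = T'.ballVerts (n + 1) := fun n =>
    ballVerts_eq_of_dist_lt (by omega) (by rw [h]; positivity)
  ext u
  have hu := Set.ext_iff.1 (key u.length) u
  simpa [ballVerts] using hu

instance : MetricSpace PlaneTree where
  dist_self := dist_self'
  dist_comm := dist_comm'
  dist_triangle := dist_triangle'
  eq_of_dist_eq_zero := eq_of_dist_eq_zero'

instance : MeasurableSpace PlaneTree := borel PlaneTree

instance : BorelSpace PlaneTree := ⟨rfl⟩

/-! ### The finite size measures -/

theorem prefix_mem (T : PlaneTree) (u w : List ℕ) (h : u ++ w ∈ T.carrier) : u ∈ T.carrier := by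
  induction w using List.reverseRecOn with
  | nil => simpa using h
  | append_singleton w i ih =>
    rw [← List.append_assoc] at h
    exact ih (T.parent_mem _ _ h)

theorem length_le_of_mem {T : PlaneTree} {N : ℕ} (hf : T.carrier.Finite) (hN : T.size = N)
    {u : List ℕ} (hu : u ∈ T.carrier) : u.length ≤ N := by
  have hsub : (fun n => u.take (n + 1)) '' (Set.Iio u.length) ⊆ T.carrier \ {[]} := by
    rintro w ⟨n, hn, rfl⟩
    have hn' : n < u.length := hn
    refine ⟨T.prefix_mem _ (u.drop (n + 1)) (by simpa using hu), ?_⟩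
    intro h
    have := congrArg List.length (show u.take (n + 1) = [] from h)
    simp at this
    subst this
    simp at hn'
  have hinj : Set.InjOn (fun n => u.take (n + 1)) (Set.Iio u.length) := by
    intro a ha b hb hab
    have ha' : a < u.length := ha
    have hb' : b < u.length := hb
    have := congrArg List.length hab
    simp only [List.length_take] at this
    omega
  have h1 := Set.ncard_le_ncard hsub (hf.subset Set.sdiff_subset)
  rw [hinj.ncard_image] at h1
  simpa [size, ← hN, Set.ncard_eq_toFinset_card'] using h1

theorem label_lt_of_mem {T : PlaneTree} {N : ℕ} (hf : T.carrier.Finite) (hN : T.size = N)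
    {u : List ℕ} {i : ℕ} (hu : u ++ [i] ∈ T.carrier) : i < N := by
  have hsub : (fun n => u ++ [n]) '' (Set.Iic i) ⊆ T.carrier \ {[]} := by
    rintro w ⟨n, hn, rfl⟩
    exact ⟨T.left_sibling_mem u i n hn hu, by simp⟩
  have hinj : Set.InjOn (fun n => u ++ [n]) (Set.Iic i) := by
    intro a _ b _ hab
    simpa using hab
  have h1 := Set.ncard_le_ncard hsub (hf.subset Set.sdiff_subset)
  rw [hinj.ncard_image] at h1
  have h2 : (Set.Iic i).ncard = i + 1 := by simp [Set.ncard_eq_toFinset_card']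
  rw [h2] at h1
  have h3 : i + 1 ≤ N := hN ▸ h1
  omega

theorem labels_lt_of_mem {T : PlaneTree} {N : ℕ} (hf : T.carrier.Finite) (hN : T.size = N)
    {u : List ℕ} (hu : u ∈ T.carrier) : ∀ i ∈ u, i < N := by
  intro i hi
  obtain ⟨s, t, rfl⟩ := List.append_of_mem hi
  refine label_lt_of_mem hf hN (T.prefix_mem (s ++ [i]) t ?_)
  simpa using hu

theorem finite_setOf_size (N : ℕ) : {T : PlaneTree | T.IsFinite ∧ T.size = N}.Finite := by
  have hfin : {u : List ℕ | u.length ≤ N ∧ ∀ i ∈ u, i < N}.Finite := by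
    refine ((List.finite_length_le (Fin N) N).image (List.map Fin.val)).subset ?_
    rintro u ⟨hl, hu⟩
    refine ⟨u.pmap (fun i h => (⟨i, h⟩ : Fin N)) hu, by simpa using hl, ?_⟩
    simp [List.map_pmap]
  refine Set.Finite.of_finite_image (f := PlaneTree.carrier) (hfin.finite_subsets.subset ?_) ?_
  · rintro _ ⟨T, ⟨hf, hN⟩, rfl⟩ u hu
    exact ⟨length_le_of_mem hf hN hu, labels_lt_of_mem hf hN hu⟩
  · intro T _ T' _ h
    exact PlaneTree.ext h

/-- The finite set of planar trees of size `N`. -/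
def treesOfSize (N : ℕ) : Finset PlaneTree := (finite_setOf_size N).toFinset

/-- The linear tree of size `N + 1`. -/
def linearTree (N : ℕ) : PlaneTree where
  carrier := {u | ∃ n ≤ N + 1, u = List.replicate n 0}
  nil_mem := ⟨0, by omega, rfl⟩
  root_edge j := by
    constructor
    · rintro ⟨n, -, h⟩
      exact List.eq_of_mem_replicate (h ▸ List.mem_singleton_self j)
    · rintro rfl
      exact ⟨1, by omega, rfl⟩
  parent_mem := by
    rintro u i ⟨n, hn, h⟩
    refine ⟨u.length, ?_, ?_⟩
    · have := congrArg List.length h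
      simp at this
      omega
    · refine List.eq_replicate_iff.2 ⟨rfl, fun b hb => ?_⟩
      exact List.eq_of_mem_replicate (h ▸ List.mem_append_left [i] hb)
  left_sibling_mem := by
    rintro u i j hj ⟨n, hn, h⟩
    have hi : i = 0 := List.eq_of_mem_replicate (h ▸ (by simp : i ∈ u ++ [i]))
    have : j = i := by omega
    exact ⟨n, hn, this ▸ h⟩
  offspring_finite := by
    intro u
    refine (Set.finite_singleton 0).subset ?_
    rintro i ⟨n, -, h⟩
    exact List.eq_of_mem_replicate (h ▸ (by simp : i ∈ u ++ [i]))

theorem linearTree_mem (N : ℕ) : linearTree N ∈ treesOfSize (N + 1) := by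
  have hc : (linearTree N).carrier = (fun n => List.replicate n 0) '' Set.Iic (N + 1) := by
    ext u
    simp [linearTree, eq_comm]
  have hd : (linearTree N).carrier \ {[]} =
      (fun n => List.replicate n 0) '' Set.Icc 1 (N + 1) := by
    rw [hc]
    ext u
    constructor
    · rintro ⟨⟨n, hn, rfl⟩, h⟩
      refine ⟨n, ⟨?_, hn⟩, rfl⟩
      by_contra h0
      have : n = 0 := by omega
      subst this
      exact h rfl
    · rintro ⟨n, ⟨h1, hn⟩, rfl⟩
      refine ⟨⟨n, hn, rfl⟩, fun h => ?_⟩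
      have := congrArg List.length (show List.replicate n 0 = [] from h)
      simp at this
      omega
  simp only [treesOfSize, Set.Finite.mem_toFinset, Set.mem_ofPred_eq]
  refine ⟨?_, ?_⟩
  · rw [IsFinite, hc]
    exact (Set.finite_Iic _).image _
  · rw [size, hd, Set.ncard_image_of_injective _ (List.replicate_left_injective 0)]
    simp [Set.ncard_eq_toFinset_card']

/-- The finite size partition function `Z_N = ∑ exp (- μ h(T))`, summed over the trees of
size `N`. -/
def partitionFunction (μ : ℝ) (N : ℕ) : ℝ :=
  ∑ T ∈ treesOfSize N, Real.exp (-μ * T.height)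

/-- The measure on the space of planar trees that is supported on the trees of size `N` and gives
mass `exp (- μ h(T)) / Z_N` to each such tree `T`. -/
def finiteSizeMeasure (μ : ℝ) (N : ℕ) : Measure PlaneTree :=
  ∑ T ∈ treesOfSize N,
    ENNReal.ofReal (Real.exp (-μ * T.height) / partitionFunction μ N) • Measure.dirac T

theorem isProbabilityMeasure_finiteSizeMeasure (μ : ℝ) (N : ℕ+) :
    IsProbabilityMeasure (finiteSizeMeasure μ N) := by
  have hpos : 0 < partitionFunction μ N := by
    refine Finset.sum_pos (fun T _ => Real.exp_pos _) ⟨linearTree (N.natPred), ?_⟩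
    have := linearTree_mem N.natPred
    rwa [PNat.natPred_add_one] at this
  constructor
  simp only [finiteSizeMeasure, Measure.coe_finsetSum, Finset.sum_apply, Measure.smul_apply,
    measure_univ, smul_eq_mul, mul_one]
  rw [← ENNReal.ofReal_sum_of_nonneg (fun T _ => by positivity), ← Finset.sum_div]
  rw [show ∑ T ∈ treesOfSize (N : ℕ), Real.exp (-μ * T.height) = partitionFunction μ N from rfl,
    div_self hpos.ne', ENNReal.ofReal_one]

/-- The measure `finiteSizeMeasure μ N` for `N = 1, 2, 3, …`, as a probability measure. -/
def finiteSizeLaw (μ : ℝ) (N : ℕ+) : ProbabilityMeasure PlaneTree :=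
  ⟨finiteSizeMeasure μ N, isProbabilityMeasure_finiteSizeMeasure μ N⟩

/-! ### The offspring probabilities and the BGW tree with a special line of descent -/

/-- The generating function `X(g) = ∑ g ^ |T|`, summed over all finite planar trees. -/
def treeSeries (g : ℝ) : ℝ := ∑' T : {T : PlaneTree // T.IsFinite}, g ^ T.1.size

/-- The critical point `g_c(k) = k / (1 + k) ^ 2`. -/
def criticalPoint (k : ℝ) : ℝ := k / (1 + k) ^ 2

/-- The offspring probabilities `p(n) = X(g_c(k)) ^ n (1 - X(g_c(k)))`. -/
def branchingProb (k : ℝ) (n : ℕ) : ℝ :=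
  treeSeries (criticalPoint k) ^ n * (1 - treeSeries (criticalPoint k))

/-- The average offspring `m = ∑ n p(n)`. -/
def meanOffspring (p : ℕ → ℝ) : ℝ := ∑' n : ℕ, (n : ℝ) * p n

/-- `p` is a subcritical offspring probability distribution. -/
structure IsSubcritical (p : ℕ → ℝ) : Prop where
  nonneg : ∀ n, 0 ≤ p n
  hasSum_one : HasSum p 1
  summable_mean : Summable fun n : ℕ => (n : ℝ) * p n
  mean_lt_one : meanOffspring p < 1

/-- The distribution `p*(n) = (n + 1) p(n + 1) / m` of the number of normal offspring of a special
individual. -/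
def sizeBiased (p : ℕ → ℝ) (n : ℕ) : ℝ := ((n : ℝ) + 1) * p (n + 1) / meanOffspring p

/-- The probability `p^s(n) = p*(n) / (n + 1)` that a special individual has `n + 1` offspring
and that the special one among them has a given position. -/
def specialProb (p : ℕ → ℝ) (n : ℕ) : ℝ := sizeBiased p n / ((n : ℝ) + 1)

/-- The probability that the tree agrees with `T₀` up to height `r = h(T₀)` and that the special
vertices up to height `r` are those on the path `ω(i)` from the vertex next to the root to the
vertex `i` at height `r`. The vertices at heights `1, …, r - 1` on this path are those that are
prefixes of `i`; such a vertex has `σ(v) - 1 ≥ 1` offspring, one of which is special. -/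
def markedWeight (p : ℕ → ℝ) (T₀ : PlaneTree) (i : List ℕ) : ℝ :=
  (∏ v ∈ T₀.innerVerts T₀.height with ¬ v <+: i, p (T₀.offspring v)) *
    ∏ v ∈ T₀.innerVerts T₀.height with v <+: i, specialProb p (T₀.offspring v - 1)

/-- `lam` is the law of the BGW tree with special and normal individuals (Kesten's size-biased
tree) associated to the offspring probabilities `p`: it is supported on the infinite trees, and
the value on the ball of radius `1 / r` around a finite tree `T₀` of height `r` is the sum of the
weights of all possible special paths in `T₀`. -/
structure IsKestenLaw (p : ℕ → ℝ) (lam : ProbabilityMeasure PlaneTree) : Prop where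
  ae_infinite : ∀ᵐ T ∂(lam : Measure PlaneTree), ¬ T.IsFinite
  measure_ball : ∀ T₀ : PlaneTree, T₀.IsFinite →
    (lam : Measure PlaneTree).real (Metric.closedBall T₀ (1 / (T₀.height : ℝ))) =
      ∑ i ∈ T₀.levelFinset T₀.height, markedWeight p T₀ i

end PlaneTree

end

/-! It suffices to bound the limiting mass of balls from below, because the candidate limit already
has total mass one. Call $Z_N$ the partition function and $g_c=k/(1+k)^2$.

Lower bound. Let $T_0$ be finite of height $r$, with $K$ vertices at height $r$ and $I$ vertices at
heights $1,\dots,r-1$. Among the trees of size $N$ in its ball, keep those with one huge branch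
above some vertex $i$ of level $r$ and branches of size at most $M$ above the others. As $k>1$, the
height factor is at least $k^{r-1}$ times that of the huge branch. Summing gives partition functions
$Z_{N-j}$, and $Z_{N-j}\ge g_c^jZ_N$ (`criticalPoint_pow_mul_heightSum_le`). After $N\to\infty$ and
then $M\to\infty$ the bound is $K k^{r-1}g_c^I X(g_c)^{K-1}$, which is exactly the mass that the
Kesten law gives to the ball (`heightSum_mul_le`, `sum_markedWeight`).

Monotonicity of $g_c^NZ_N$. If $A_m$ is the generating series of trees of height at most $m$, then
$A_{m+1}=x+A_mA_{m+1}$. Eliminating between consecutive equations gives a recurrence for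
$A_{m+1}-A_m$ whose quadratic term has nonnegative coefficients. Dropping it bounds the number of
trees by size and height through a three-term sum with weights $1,2,1$. Weighting by $k^h$ turns
these into $k+2+1/k=1/g_c$ (`heightDiff_recurrence`, `heightSum_succ_le`).

Limit. An open set is, up to finite trees, a countable disjoint union of balls around finite trees.
Fatou's lemma adds up the lower bounds, and the portmanteau theorem gives weak convergence to any
Kesten law (`tendsto_finiteSizeLaw`). Uniqueness of the law is then uniqueness of the weak limit.

Existence and spine. Here $X(g_c)=1/(1+k)$, so $p$ is geometric with mean $1/k$. For a geometric
law, the numbers of normal siblings to the left and right of a special child are independent with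
law $p$ (`siteLaw_singleton`), so Kesten's tree is a function of i.i.d. pairs indexed by words.
Branches off the spine are subcritical, hence almost surely finite. -/

noncomputable section

namespace PlaneTree

/-! ### Trees given by their offspring numbers -/

/-- The word `w` is a vertex of the tree in which every vertex `v` has `o v` offspring. -/
def InTree : (List ℕ → ℕ) → List ℕ → Prop
  | _, [] => True
  | o, j :: w => j < o [] ∧ InTree (fun v => o (j :: v)) w

@[simp] theorem inTree_nil (o : List ℕ → ℕ) : InTree o [] := trivial

@[simp] theorem inTree_cons (o : List ℕ → ℕ) (j : ℕ) (w : List ℕ) :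
    InTree o (j :: w) ↔ j < o [] ∧ InTree (fun v => o (j :: v)) w := Iff.rfl

theorem inTree_append (o : List ℕ → ℕ) (u w : List ℕ) :
    InTree o (u ++ w) ↔ InTree o u ∧ InTree (fun v => o (u ++ v)) w := by
  induction u generalizing o with
  | nil => simp
  | cons j u ih => simp [ih, and_assoc]

theorem inTree_append_singleton (o : List ℕ → ℕ) (u : List ℕ) (i : ℕ) :
    InTree o (u ++ [i]) ↔ InTree o u ∧ i < o u := by
  simp [inTree_append]

theorem inTree_congr {o o' : List ℕ → ℕ} {w : List ℕ}
    (h : ∀ v, v.length < w.length → InTree o v → o v = o' v) (hw : InTree o w) : InTree o' w := by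
  induction w using List.reverseRecOn with
  | nil => trivial
  | append_singleton w i ih =>
    rw [inTree_append_singleton] at hw ⊢
    refine ⟨ih (fun v hv hv' => h v (by simp; omega) hv') hw.1, ?_⟩
    rw [← h w (by simp) hw.1]
    exact hw.2

/-- The planar tree in which every vertex `v` has `o v` offspring. -/
def ofOffspring (o : List ℕ → ℕ) (ho : o [] = 1) : PlaneTree where
  carrier := {w | InTree o w}
  nil_mem := trivial
  root_edge j := by simp [ho]
  parent_mem u i h := ((inTree_append_singleton o u i).1 h).1
  left_sibling_mem u i j hj h := by
    have h' := (inTree_append_singleton o u i).1 h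
    exact (inTree_append_singleton o u j).2 ⟨h'.1, hj.trans_lt h'.2⟩
  offspring_finite u := (Set.finite_Iio (o u)).subset fun i h =>
    ((inTree_append_singleton o u i).1 h).2

theorem mem_ofOffspring {o : List ℕ → ℕ} {ho : o [] = 1} {w : List ℕ} :
    w ∈ (ofOffspring o ho).carrier ↔ InTree o w := Iff.rfl

/-- The labels of the offspring are finite in number and closed under passing to the left, so they
form an initial segment. Hence offspring numbers determine the tree. -/
theorem append_singleton_mem_iff (T : PlaneTree) (v : List ℕ) (i : ℕ) :
    v ++ [i] ∈ T.carrier ↔ i < T.offspring v := by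
  have hfin := T.offspring_finite v
  constructor
  · intro h
    have hsub : Set.Iic i ⊆ {i | v ++ [i] ∈ T.carrier} := fun j hj =>
      T.left_sibling_mem v i j hj h
    have := Set.ncard_le_ncard hsub hfin
    rw [Set.ncard_eq_toFinset_card'] at this
    simp at this
    exact this
  · intro h
    by_contra hi
    have hsub : {i | v ++ [i] ∈ T.carrier} ⊆ Set.Iio i := by
      intro j hj
      by_contra hji
      exact hi (T.left_sibling_mem v j i (by simpa using hji) hj)
    have := Set.ncard_le_ncard hsub (Set.finite_Iio i)
    rw [Set.ncard_eq_toFinset_card' (Set.Iio i)] at this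
    simp only [Set.toFinset_Iio, Nat.card_Iio] at this
    exact absurd (h.trans_le this) (lt_irrefl _)

theorem mem_iff_inTree (T : PlaneTree) (w : List ℕ) :
    w ∈ T.carrier ↔ InTree T.offspring w := by
  induction w using List.reverseRecOn with
  | nil => exact iff_of_true T.nil_mem trivial
  | append_singleton w i ih =>
    rw [inTree_append_singleton, ← ih, ← append_singleton_mem_iff]
    exact ⟨fun h => ⟨T.parent_mem w i h, h⟩, fun h => h.2⟩

theorem offspring_ofOffspring {o : List ℕ → ℕ} {ho : o [] = 1} {v : List ℕ}
    (hv : InTree o v) : (ofOffspring o ho).offspring v = o v := by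
  have : ∀ i, i < (ofOffspring o ho).offspring v ↔ i < o v := fun i => by
    rw [← append_singleton_mem_iff, mem_ofOffspring, inTree_append_singleton]
    simp [hv]
  exact le_antisymm (le_of_not_gt fun h => lt_irrefl _ ((this _).1 h))
    (le_of_not_gt fun h => lt_irrefl _ ((this _).2 h))

theorem offspring_nil (T : PlaneTree) : T.offspring [] = 1 := by
  have : ∀ i, i < T.offspring [] ↔ i = 0 := fun i => by
    rw [← append_singleton_mem_iff]
    exact T.root_edge i
  have h0 := this 0
  have h1 := this 1
  omega

theorem head_eq_zero {T : PlaneTree} {j : ℕ} {w : List ℕ} (h : j :: w ∈ T.carrier) : j = 0 := by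
  rw [mem_iff_inTree, inTree_cons, offspring_nil] at h
  omega

theorem zero_mem (T : PlaneTree) : [0] ∈ T.carrier := (T.root_edge 0).2 rfl

theorem ext_cons {T T' : PlaneTree} (h : ∀ w, 0 :: w ∈ T.carrier ↔ 0 :: w ∈ T'.carrier) :
    T = T' := by
  ext w
  rcases w with _ | ⟨j, w⟩
  · exact iff_of_true T.nil_mem T'.nil_mem
  · by_cases hj : j = 0
    · subst hj; exact h w
    · exact iff_of_false (fun h => hj (head_eq_zero h)) (fun h => hj (head_eq_zero h))

/-- Agreement need only be tested at the vertices of one tree: induction on length carries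
membership over to the other. -/
theorem ballVerts_eq_iff (T T' : PlaneTree) (r : ℕ) :
    T.ballVerts r = T'.ballVerts r ↔
      ∀ v ∈ T'.carrier, v.length < r → T.offspring v = T'.offspring v := by
  constructor
  · intro h v _ hvr
    have key : ∀ i, i < T.offspring v ↔ i < T'.offspring v := fun i => by
      have := Set.ext_iff.1 h (v ++ [i])
      simp only [ballVerts, Set.mem_ofPred_eq, List.length_append, List.length_singleton] at this
      rw [← append_singleton_mem_iff, ← append_singleton_mem_iff]
      have hr : v.length + 1 ≤ r := hvr
      simpa [hr] using this
    exact le_antisymm (le_of_not_gt fun h => lt_irrefl _ ((key _).1 h))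
      (le_of_not_gt fun h => lt_irrefl _ ((key _).2 h))
  · intro h
    have key : ∀ w : List ℕ, w.length ≤ r → (w ∈ T.carrier ↔ w ∈ T'.carrier) := by
      intro w
      induction w using List.reverseRecOn with
      | nil => exact fun _ => iff_of_true T.nil_mem T'.nil_mem
      | append_singleton w i ih =>
        intro hw
        have hw' : w.length < r := by simpa using hw
        have ih' := ih hw'.le
        constructor
        · intro hm
          have h1 := ih'.1 (T.parent_mem w i hm)
          rw [append_singleton_mem_iff] at hm ⊢
          rwa [← h w h1 hw']
        · intro hm
          have h1 := T'.parent_mem w i hm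
          rw [append_singleton_mem_iff] at hm ⊢
          rwa [h w h1 hw']
    ext w
    simp only [ballVerts, Set.mem_ofPred_eq]
    exact ⟨fun hw => ⟨(key w hw.2).1 hw.1, hw.2⟩, fun hw => ⟨(key w hw.2).2 hw.1, hw.2⟩⟩

/-! ### Size and height of finite trees -/

theorem mem_treesOfSize {T : PlaneTree} {N : ℕ} :
    T ∈ treesOfSize N ↔ T.IsFinite ∧ T.size = N := by
  simp [treesOfSize]

theorem bddAbove_levels {T : PlaneTree} (hT : T.IsFinite) :
    BddAbove {r | (T.level r).Nonempty} := by
  refine ⟨T.size, ?_⟩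
  rintro r ⟨u, hu, rfl⟩
  exact length_le_of_mem hT rfl hu

theorem height_le_iff {T : PlaneTree} (hT : T.IsFinite) {m : ℕ} :
    T.height ≤ m ↔ ∀ w ∈ T.carrier, w.length ≤ m := by
  constructor
  · intro h w hw
    exact (le_csSup (bddAbove_levels hT) ⟨w, hw, rfl⟩).trans h
  · intro h
    refine csSup_le ⟨0, [], T.nil_mem, rfl⟩ ?_
    rintro r ⟨u, hu, rfl⟩
    exact h u hu

theorem length_le_height {T : PlaneTree} (hT : T.IsFinite) {w : List ℕ} (hw : w ∈ T.carrier) :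
    w.length ≤ T.height := (height_le_iff hT).1 le_rfl w hw

theorem exists_length_eq_height {T : PlaneTree} (hT : T.IsFinite) :
    ∃ w ∈ T.carrier, w.length = T.height := by
  have : T.height ∈ {r | (T.level r).Nonempty} :=
    Nat.sSup_mem ⟨0, [], T.nil_mem, rfl⟩ (bddAbove_levels hT)
  obtain ⟨w, hw⟩ := this
  exact ⟨w, hw⟩

theorem one_le_height {T : PlaneTree} (hT : T.IsFinite) : 1 ≤ T.height :=
  length_le_height hT T.zero_mem

theorem height_le_size {T : PlaneTree} (hT : T.IsFinite) : T.height ≤ T.size :=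
  (height_le_iff hT).2 fun _ hw => length_le_of_mem hT rfl hw

theorem one_le_size {T : PlaneTree} (hT : T.IsFinite) : 1 ≤ T.size :=
  (one_le_height hT).trans (height_le_size hT)

theorem sdiff_nil_eq (T : PlaneTree) : T.carrier \ {[]} = List.cons 0 '' {w | 0 :: w ∈ T.carrier} := by
  ext w
  rcases w with _ | ⟨j, w⟩
  · simp
  · simp only [Set.mem_sdiff, Set.mem_singleton_iff, reduceCtorEq, not_false_eq_true, and_true,
      Set.mem_image, Set.mem_ofPred_eq, List.cons.injEq, exists_eq_right_right]
    constructor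
    · intro h
      have := head_eq_zero h
      subst this
      exact ⟨h, rfl⟩
    · rintro ⟨h, rfl⟩
      exact h

theorem size_eq (T : PlaneTree) : T.size = {w | 0 :: w ∈ T.carrier}.ncard := by
  rw [size, sdiff_nil_eq, Set.ncard_image_of_injective _ List.cons_injective]

theorem isFinite_iff (T : PlaneTree) : T.IsFinite ↔ {w | 0 :: w ∈ T.carrier}.Finite := by
  constructor
  · intro h
    exact (Set.Finite.subset h (by rintro _ ⟨w, hw, rfl⟩; exact hw)).of_finite_image
      (f := List.cons 0) (List.cons_injective.injOn)
  · intro h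
    have := h.image (List.cons 0)
    rw [← sdiff_nil_eq] at this
    refine (this.insert []).subset fun w hw => ?_
    by_cases h : w = []
    · exact Or.inl h
    · exact Or.inr ⟨hw, h⟩

theorem mem_levelFinset {T : PlaneTree} {r : ℕ} {u : List ℕ} :
    u ∈ T.levelFinset r ↔ u ∈ T.carrier ∧ u.length = r := by
  simp [levelFinset, level]

theorem mem_innerVerts {T : PlaneTree} {r : ℕ} {u : List ℕ} :
    u ∈ T.innerVerts r ↔ u ∈ T.carrier ∧ 1 ≤ u.length ∧ u.length < r := by
  simp only [innerVerts, Finset.mem_biUnion, Finset.mem_Ico, mem_levelFinset]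
  constructor
  · rintro ⟨s, hs, hu, rfl⟩
    exact ⟨hu, hs⟩
  · rintro ⟨hu, h⟩
    exact ⟨_, h, hu, rfl⟩

/-! ### The decomposition of a tree at its lowest branch -/

/-- The tree that is obtained from `R` by attaching `L` as a new leftmost branch to the vertex
next to the root. -/
def join (L R : PlaneTree) : PlaneTree :=
  ofOffspring (fun
    | [] => 1
    | [_] => R.offspring [0] + 1
    | _ :: 0 :: w => L.offspring (0 :: w)
    | _ :: (j + 1) :: w => R.offspring (0 :: j :: w)) rfl

theorem mem_join_zero {L R : PlaneTree} {w : List ℕ} :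
    0 :: 0 :: w ∈ (join L R).carrier ↔ 0 :: w ∈ L.carrier := by
  rw [join, mem_ofOffspring, mem_iff_inTree L]
  simp [offspring_nil]

theorem mem_join_succ {L R : PlaneTree} {j : ℕ} {w : List ℕ} :
    0 :: (j + 1) :: w ∈ (join L R).carrier ↔ 0 :: j :: w ∈ R.carrier := by
  rw [join, mem_ofOffspring, mem_iff_inTree R]
  simp [offspring_nil]

/-- The leftmost branch of the vertex next to the root. -/
def left (T : PlaneTree) : PlaneTree :=
  ofOffspring (fun
    | [] => 1
    | _ :: w => T.offspring (0 :: 0 :: w)) rfl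

/-- The tree without the leftmost branch of the vertex next to the root. -/
def right (T : PlaneTree) : PlaneTree :=
  ofOffspring (fun
    | [] => 1
    | [_] => T.offspring [0] - 1
    | _ :: j :: w => T.offspring (0 :: (j + 1) :: w)) rfl

theorem mem_left {T : PlaneTree} (hT : [0, 0] ∈ T.carrier) {w : List ℕ} :
    0 :: w ∈ T.left.carrier ↔ 0 :: 0 :: w ∈ T.carrier := by
  have := (append_singleton_mem_iff T [0] 0).1 hT
  rw [left, mem_ofOffspring, mem_iff_inTree T]
  simp [offspring_nil, this]

theorem mem_right {T : PlaneTree} {j : ℕ} {w : List ℕ} :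
    0 :: j :: w ∈ T.right.carrier ↔ 0 :: (j + 1) :: w ∈ T.carrier := by
  rw [right, mem_ofOffspring, mem_iff_inTree T]
  simp [offspring_nil]
  intro _
  omega

theorem join_left_right {T : PlaneTree} (hT : [0, 0] ∈ T.carrier) : join T.left T.right = T := by
  refine ext_cons fun w => ?_
  rcases w with _ | ⟨_ | j, w⟩
  · exact iff_of_true (zero_mem _) (zero_mem _)
  · rw [mem_join_zero, mem_left hT]
  · rw [mem_join_succ, mem_right]

theorem join_injective {L R L' R' : PlaneTree} (h : join L R = join L' R') :
    L = L' ∧ R = R' := by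
  constructor
  · refine ext_cons fun w => ?_
    have := @mem_join_zero L R w
    rw [h, mem_join_zero] at this
    exact this.symm
  · refine ext_cons fun w => ?_
    rcases w with _ | ⟨j, w⟩
    · exact iff_of_true (zero_mem _) (zero_mem _)
    · have := @mem_join_succ L R j w
      rw [h, mem_join_succ] at this
      exact this.symm

/-- Embedding of the vertices of the right part of a joined tree. -/
def shiftHead : List ℕ → List ℕ
  | [] => []
  | j :: w => (j + 1) :: w

theorem shiftHead_injective : Function.Injective shiftHead := by
  rintro (_ | ⟨i, u⟩) (_ | ⟨j, w⟩) h <;> simp_all [shiftHead]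

theorem join_verts (L R : PlaneTree) : {w | 0 :: w ∈ (join L R).carrier} =
    List.cons 0 '' {w | 0 :: w ∈ L.carrier} ∪ shiftHead '' {w | 0 :: w ∈ R.carrier} := by
  ext w
  rcases w with _ | ⟨_ | j, w⟩
  · simp only [Set.mem_ofPred_eq, zero_mem, Set.mem_union, true_iff]
    exact Or.inr ⟨[], R.zero_mem, rfl⟩
  · simp only [Set.mem_ofPred_eq, mem_join_zero, Set.mem_union]
    constructor
    · intro h
      exact Or.inl ⟨w, h, rfl⟩
    · rintro (⟨v, hv, h⟩ | ⟨v, hv, h⟩)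
      · rw [List.cons.injEq] at h
        exact h.2 ▸ hv
      · rcases v with _ | ⟨i, v⟩ <;> simp [shiftHead] at h
  · simp only [Set.mem_ofPred_eq, mem_join_succ, Set.mem_union]
    constructor
    · intro h
      exact Or.inr ⟨j :: w, h, rfl⟩
    · rintro (⟨v, hv, h⟩ | ⟨v, hv, h⟩)
      · simp at h
      · rcases v with _ | ⟨i, v⟩
        · simp [shiftHead] at h
        · simp only [shiftHead, List.cons.injEq, Nat.add_right_cancel_iff] at h
          obtain ⟨rfl, rfl⟩ := h
          exact hv

theorem join_isFinite_iff {L R : PlaneTree} :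
    (join L R).IsFinite ↔ L.IsFinite ∧ R.IsFinite := by
  rw [isFinite_iff, join_verts, Set.finite_union,
    Set.finite_image_iff List.cons_injective.injOn,
    Set.finite_image_iff shiftHead_injective.injOn, ← isFinite_iff, ← isFinite_iff]

theorem size_join {L R : PlaneTree} (hL : L.IsFinite) (hR : R.IsFinite) :
    (join L R).size = L.size + R.size := by
  rw [size_eq, join_verts, Set.ncard_union_eq ?_ (((isFinite_iff L).1 hL).image _)
    (((isFinite_iff R).1 hR).image _), Set.ncard_image_of_injective _ List.cons_injective,
    Set.ncard_image_of_injective _ shiftHead_injective, ← size_eq, ← size_eq]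
  rw [Set.disjoint_left]
  rintro _ ⟨v, -, rfl⟩ ⟨w, -, h⟩
  rcases w with _ | ⟨i, w⟩ <;> simp [shiftHead] at h

/-- The branch `L` is lifted by one level while `R` keeps its position; hence the asymmetric bounds.
-/
theorem height_join_le_iff {L R : PlaneTree} (hL : L.IsFinite) (hR : R.IsFinite) {m : ℕ} :
    (join L R).height ≤ m + 1 ↔ L.height ≤ m ∧ R.height ≤ m + 1 := by
  rw [height_le_iff (join_isFinite_iff.2 ⟨hL, hR⟩), height_le_iff hL, height_le_iff hR]
  constructor
  · intro h
    constructor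
    · rintro (_ | ⟨i, w⟩) hw
      · simp
      · have := head_eq_zero hw
        subst this
        simpa using h _ (mem_join_zero (R := R).2 hw)
    · rintro (_ | ⟨i, _ | ⟨j, w⟩⟩) hw
      · simp
      · simp
      · have := head_eq_zero hw
        subst this
        simpa using h _ (mem_join_succ (L := L).2 hw)
  · rintro ⟨h1, h2⟩ w hw
    rcases w with _ | ⟨i, w⟩
    · simp
    have := head_eq_zero hw
    subst this
    rcases w with _ | ⟨_ | j, w⟩
    · simp
    · simpa using h1 _ (mem_join_zero.1 hw)
    · simpa using h2 _ (mem_join_succ.1 hw)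

/-- The tree with a single edge. -/
def edge : PlaneTree := linearTree 0

theorem edge_mem_treesOfSize : edge ∈ treesOfSize 1 := linearTree_mem 0

theorem eq_edge {T : PlaneTree} (hT : [0, 0] ∉ T.carrier) : T = edge := by
  refine ext_cons fun w => ?_
  rcases w with _ | ⟨j, w⟩
  · exact iff_of_true (zero_mem _) (zero_mem _)
  · refine iff_of_false (fun h => hT ?_) ?_
    · have h1 : [0] ++ [j] ∈ T.carrier := T.prefix_mem _ w (by simpa using h)
      exact T.left_sibling_mem [0] j 0 (Nat.zero_le _) h1
    · rintro ⟨n, hn, h⟩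
      have := congrArg List.length h
      simp at this
      omega

theorem size_edge : edge.size = 1 := (mem_treesOfSize.1 edge_mem_treesOfSize).2

theorem isFinite_edge : edge.IsFinite := (mem_treesOfSize.1 edge_mem_treesOfSize).1

theorem height_edge : edge.height = 1 :=
  le_antisymm ((height_le_size isFinite_edge).trans_eq size_edge) (one_le_height isFinite_edge)

theorem join_ne_edge (L R : PlaneTree) : join L R ≠ edge := by
  intro h
  have h1 : [0, 0] ∈ (join L R).carrier := mem_join_zero.2 L.zero_mem
  rw [h] at h1
  simpa [height_edge] using length_le_height isFinite_edge h1

theorem eq_edge_or_join {T : PlaneTree} (hT : T.IsFinite) :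
    T = edge ∨ ∃ L R : PlaneTree, L.IsFinite ∧ R.IsFinite ∧ T = join L R := by
  by_cases h : [0, 0] ∈ T.carrier
  · have := join_left_right h
    rw [← this] at hT
    exact Or.inr ⟨_, _, (join_isFinite_iff.1 hT).1, (join_isFinite_iff.1 hT).2, this.symm⟩
  · exact Or.inl (eq_edge h)

/-! ### Trees of bounded height -/

/-- The planar trees of size `n` and height at most `m`. -/
def treesOfHeightLE (n m : ℕ) : Finset PlaneTree := {T ∈ treesOfSize n | T.height ≤ m}

theorem mem_treesOfHeightLE {T : PlaneTree} {n m : ℕ} :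
    T ∈ treesOfHeightLE n m ↔ T.IsFinite ∧ T.size = n ∧ T.height ≤ m := by
  simp [treesOfHeightLE, mem_treesOfSize, and_assoc]

theorem card_treesOfHeightLE_zero (n : ℕ) : (treesOfHeightLE n 0).card = 0 := by
  rw [Finset.card_eq_zero, Finset.eq_empty_iff_forall_notMem]
  intro T hT
  rw [mem_treesOfHeightLE] at hT
  have := one_le_height hT.1
  omega

-- A tree other than the single edge is uniquely a `join`. This is the combinatorial form of
-- $A_{m+1}=x+A_mA_{m+1}$.
open Classical in
theorem card_treesOfHeightLE_succ (n m : ℕ) : (treesOfHeightLE n (m + 1)).card =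
    (if n = 1 then 1 else 0) + ∑ p ∈ Finset.HasAntidiagonal.antidiagonal n,
      (treesOfHeightLE p.1 m).card * (treesOfHeightLE p.2 (m + 1)).card := by
  rw [← Finset.card_filter_add_card_filter_not (fun T => T = edge)]
  congr 1
  · split_ifs with h
    · subst h
      rw [Finset.card_eq_one]
      refine ⟨edge, ?_⟩
      ext T
      simp only [Finset.mem_filter, mem_treesOfHeightLE, Finset.mem_singleton]
      constructor
      · exact fun h => h.2
      · rintro rfl
        exact ⟨⟨isFinite_edge, size_edge, by rw [height_edge]; omega⟩, rfl⟩
    · rw [Finset.card_eq_zero, Finset.eq_empty_iff_forall_notMem]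
      simp only [Finset.mem_filter, mem_treesOfHeightLE]
      rintro T ⟨⟨-, h1, -⟩, rfl⟩
      exact h (h1 ▸ size_edge)
  · simp_rw [← Finset.card_product]
    rw [← Finset.card_sigma]
    symm
    refine Finset.card_bij (fun x _ => join x.2.1 x.2.2) ?_ ?_ ?_
    · rintro ⟨⟨a, b⟩, L, R⟩ h
      simp only [Finset.mem_sigma, Finset.HasAntidiagonal.mem_antidiagonal, Finset.mem_product,
        mem_treesOfHeightLE] at h
      obtain ⟨hab, ⟨hL, hLa, hLm⟩, hR, hRb, hRm⟩ := h
      simp only [Finset.mem_filter, mem_treesOfHeightLE]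
      refine ⟨⟨join_isFinite_iff.2 ⟨hL, hR⟩, ?_, (height_join_le_iff hL hR).2 ⟨hLm, hRm⟩⟩,
        join_ne_edge _ _⟩
      rw [size_join hL hR]
      omega
    · rintro ⟨⟨a, b⟩, L, R⟩ h ⟨⟨a', b'⟩, L', R'⟩ h' he
      simp only [Finset.mem_sigma, Finset.mem_product, mem_treesOfHeightLE] at h h'
      obtain ⟨rfl, rfl⟩ := join_injective he
      obtain rfl : a = a' := h.2.1.2.1.symm.trans h'.2.1.2.1
      obtain rfl : b = b' := h.2.2.2.1.symm.trans h'.2.2.2.1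
      rfl
    · intro T hT
      simp only [Finset.mem_filter, mem_treesOfHeightLE] at hT
      obtain ⟨⟨hf, hn, hm⟩, hne⟩ := hT
      obtain rfl | ⟨L, R, hL, hR, rfl⟩ := eq_edge_or_join hf
      · exact absurd rfl hne
      rw [height_join_le_iff hL hR] at hm
      rw [size_join hL hR] at hn
      refine ⟨⟨⟨L.size, R.size⟩, L, R⟩, ?_, rfl⟩
      simp only [Finset.mem_sigma, Finset.HasAntidiagonal.mem_antidiagonal, Finset.mem_product,
        mem_treesOfHeightLE]
      exact ⟨hn, ⟨hL, trivial, hm.1⟩, hR, trivial, hm.2⟩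

/-- The generating series of the trees of height at most `m`. -/
def heightSeries (m : ℕ) : PowerSeries ℝ :=
  PowerSeries.mk fun n => ((treesOfHeightLE n m).card : ℝ)

theorem heightSeries_succ (m : ℕ) :
    heightSeries (m + 1) = PowerSeries.X + heightSeries m * heightSeries (m + 1) := by
  ext n
  simp only [heightSeries, PowerSeries.coeff_mk, map_add, PowerSeries.coeff_X,
    PowerSeries.coeff_mul]
  exact_mod_cast card_treesOfHeightLE_succ n m

/-- The number of trees of size `n` and height `m`. -/
def heightCount (n m : ℕ) : ℕ := {T ∈ treesOfSize n | T.height = m}.card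

theorem card_treesOfHeightLE_add (n m : ℕ) :
    (treesOfHeightLE n (m + 1)).card = (treesOfHeightLE n m).card + heightCount n (m + 1) := by
  classical
  rw [treesOfHeightLE, treesOfHeightLE, heightCount, ← Finset.card_union_of_disjoint]
  · congr 1
    ext T
    simp only [Finset.mem_filter, Finset.mem_union, ← and_or_left, Nat.le_succ_iff]
  · rw [Finset.disjoint_filter]
    intro T _ h1 h2
    omega

theorem heightCount_zero (n : ℕ) : heightCount n 0 = 0 := by
  simpa [heightCount, treesOfHeightLE] using card_treesOfHeightLE_zero n

/-- The generating series of the trees of height `m + 1`. -/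
def heightDiff (m : ℕ) : PowerSeries ℝ := heightSeries (m + 1) - heightSeries m

theorem coeff_heightDiff (n m : ℕ) :
    PowerSeries.coeff n (heightDiff m) = (heightCount n (m + 1) : ℝ) := by
  simp [heightDiff, heightSeries, card_treesOfHeightLE_add]

/-- All terms have nonnegative coefficients, so discarding the product of differences leaves a
linear inequality between counts. -/
theorem heightDiff_recurrence (m : ℕ) :
    PowerSeries.X * (heightDiff m + 2 * heightDiff (m + 1) + heightDiff (m + 2)) =
      heightDiff (m + 1) * (1 + (heightDiff m + heightDiff (m + 1) + heightDiff (m + 2))) := by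
  have h1 := heightSeries_succ m
  have h2 := heightSeries_succ (m + 1)
  have h3 := heightSeries_succ (m + 2)
  simp only [heightDiff, show m + 1 + 1 = m + 2 from rfl, show m + 2 + 1 = m + 3 from rfl]
    at h1 h2 h3 ⊢
  generalize heightSeries m = A at *
  generalize heightSeries (m + 1) = B at *
  generalize heightSeries (m + 2) = C at *
  generalize heightSeries (m + 3) = D at *
  have e1 : PowerSeries.X = B * (1 - A) := by linear_combination -h1
  have e2 : PowerSeries.X = C * (1 - B) := by linear_combination -h2
  have e3 : PowerSeries.X = D * (1 - C) := by linear_combination -h3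
  -- Subtracting consecutive equations expresses each outer difference through the middle one, `C -
  -- B`. The products `A * B` and `C * D` left over are removed with `h1` and `h3`.
  have k1 : PowerSeries.X * (B - A) = (C - B) * ((1 - B) * (1 - A)) := by
    linear_combination (1 - A) * e2 - (1 - B) * e1
  have k2 : PowerSeries.X * (D - C) = (C - B) * (D * C) := by
    linear_combination D * e2 - C * e3
  linear_combination k1 + k2 + (C - B) * (-h1 - h3)

theorem heightCount_succ_le (n m : ℕ) : heightCount (n + 1) (m + 2) ≤
    heightCount n (m + 1) + 2 * heightCount n (m + 2) + heightCount n (m + 3) := by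
  have h := congrArg (PowerSeries.coeff (n + 1)) (heightDiff_recurrence m)
  rw [mul_add (heightDiff _), mul_one, map_add, mul_comm PowerSeries.X, PowerSeries.coeff_succ_mul_X,
    PowerSeries.coeff_mul, two_mul] at h
  simp only [map_add, coeff_heightDiff] at h
  have hnn : (0 : ℝ) ≤ ∑ p ∈ Finset.HasAntidiagonal.antidiagonal (n + 1), (heightCount p.1 (m + 1 + 1) : ℝ) *
      (heightCount p.2 (m + 1) + heightCount p.2 (m + 1 + 1) + heightCount p.2 (m + 2 + 1)) :=
    Finset.sum_nonneg fun _ _ => by positivity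
  have : (heightCount (n + 1) (m + 2) : ℝ) ≤
      heightCount n (m + 1) + 2 * heightCount n (m + 2) + heightCount n (m + 3) := by
    simp only [show m + 1 + 1 = m + 2 from rfl, show m + 2 + 1 = m + 3 from rfl] at h hnn
    linarith
  exact_mod_cast this

theorem heightCount_one {n : ℕ} (hn : n ≠ 1) : heightCount n 1 = 0 := by
  rw [heightCount, Finset.card_eq_zero, Finset.eq_empty_iff_forall_notMem]
  intro T hT
  rw [Finset.mem_filter, mem_treesOfSize] at hT
  obtain ⟨⟨hf, hs⟩, hh⟩ := hT
  obtain rfl | ⟨L, R, hL, hR, rfl⟩ := eq_edge_or_join hf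
  · exact hn (hs ▸ size_edge)
  · have := ((height_join_le_iff (m := 0) hL hR).1 hh.le).1
    have := one_le_height hL
    omega

/-! ### The partition functions -/

/-- The sum of `k ^ h(T)` over the trees `T` of size `n`. -/
def heightSum (k : ℝ) (n : ℕ) : ℝ := ∑ T ∈ treesOfSize n, k ^ T.height

theorem partitionFunction_eq (μ : ℝ) (n : ℕ) :
    partitionFunction μ n = heightSum (Real.exp (-μ)) n := by
  refine Finset.sum_congr rfl fun T _ => ?_
  rw [← Real.exp_nat_mul, mul_comm]

theorem heightSum_eq (k : ℝ) {n H : ℕ} (hH : n < H) :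
    heightSum k n = ∑ h ∈ Finset.range H, k ^ h * heightCount n h := by
  rw [heightSum, ← Finset.sum_fiberwise_of_maps_to (t := Finset.range H) (g := height)]
  · refine Finset.sum_congr rfl fun h _ => ?_
    rw [heightCount, Finset.sum_congr rfl (g := fun _ => k ^ h)
      (fun T hT => by rw [(Finset.mem_filter.1 hT).2]), Finset.sum_const, nsmul_eq_mul, mul_comm]
  · intro T hT
    rw [mem_treesOfSize] at hT
    have := height_le_size hT.1
    rw [Finset.mem_range]
    omega

theorem sum_shift_le_heightSum {k : ℝ} (hk : 0 ≤ k) (n j H : ℕ) :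
    ∑ h ∈ Finset.range H, k ^ (h + j) * heightCount n (h + j) ≤ heightSum k n := by
  rw [heightSum_eq k (show n < n + 1 + (H + j) by omega)]
  calc _ = ∑ h ∈ (Finset.range H).map (addRightEmbedding j), k ^ h * (heightCount n h : ℝ) := by
        rw [Finset.sum_map]; rfl
    _ ≤ _ := by
        refine Finset.sum_le_sum_of_subset_of_nonneg ?_ fun _ _ _ => by positivity
        intro h hh
        simp only [Finset.mem_map, Finset.mem_range, addRightEmbedding_apply] at hh ⊢
        omega

/-- Multiply `heightCount_succ_le` by `k ^ (h + 3)` and sum: the shifts in height produce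
$k^2+2k+1=(1+k)^2$. -/
theorem heightSum_succ_le {k : ℝ} (hk : 0 < k) {n : ℕ} (hn : 1 ≤ n) :
    k * heightSum k (n + 1) ≤ (1 + k) ^ 2 * heightSum k n := by
  -- Since `n + 1 ≥ 2`, heights `0` and `1` do not occur, so every term is in the range of the
  -- three-term bound.
  have e : heightSum k (n + 1) =
      ∑ h ∈ Finset.range (n + 1), k ^ (h + 2) * (heightCount (n + 1) (h + 2) : ℝ) := by
    rw [heightSum_eq k (show n + 1 < (n + 1) + 2 by omega), Finset.sum_range_succ',
      Finset.sum_range_succ', heightCount_zero, heightCount_one (by omega)]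
    simp
  have h1 := sum_shift_le_heightSum hk.le n 1 (n + 1)
  have h2 := sum_shift_le_heightSum hk.le n 2 (n + 1)
  have h3 := sum_shift_le_heightSum hk.le n 3 (n + 1)
  have key : k * heightSum k (n + 1) ≤
      k ^ 2 * ∑ h ∈ Finset.range (n + 1), k ^ (h + 1) * (heightCount n (h + 1) : ℝ) +
      2 * k * ∑ h ∈ Finset.range (n + 1), k ^ (h + 2) * (heightCount n (h + 2) : ℝ) +
      ∑ h ∈ Finset.range (n + 1), k ^ (h + 3) * (heightCount n (h + 3) : ℝ) := by
    rw [e, Finset.mul_sum, Finset.mul_sum, Finset.mul_sum, ← Finset.sum_add_distrib,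
      ← Finset.sum_add_distrib]
    refine Finset.sum_le_sum fun h _ => ?_
    have hc : (heightCount (n + 1) (h + 2) : ℝ) ≤
        heightCount n (h + 1) + 2 * heightCount n (h + 2) + heightCount n (h + 3) := by
      exact_mod_cast heightCount_succ_le n h
    calc k * (k ^ (h + 2) * (heightCount (n + 1) (h + 2) : ℝ))
        ≤ k * (k ^ (h + 2) *
          (heightCount n (h + 1) + 2 * heightCount n (h + 2) + heightCount n (h + 3))) := by
          gcongr
      _ = _ := by ring
  have h1' := mul_le_mul_of_nonneg_left h1 (sq_nonneg k)
  have h2' := mul_le_mul_of_nonneg_left h2 (show 0 ≤ 2 * k by positivity)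
  calc _ ≤ _ := key
    _ ≤ k ^ 2 * heightSum k n + 2 * k * heightSum k n + heightSum k n := by gcongr
    _ = _ := by ring

theorem heightSum_pos {k : ℝ} (hk : 0 < k) {n : ℕ} (hn : 1 ≤ n) : 0 < heightSum k n := by
  obtain ⟨n, rfl⟩ := Nat.exists_eq_add_of_le' hn
  exact Finset.sum_pos (fun T _ => by positivity) ⟨_, linearTree_mem n⟩

theorem criticalPoint_pos {k : ℝ} (hk : 0 < k) : 0 < criticalPoint k := by
  rw [criticalPoint]
  positivity

/-- At the critical point the partition functions decrease, up to the exponential factor. -/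
theorem criticalPoint_pow_mul_heightSum_le {k : ℝ} (hk : 0 < k) {n : ℕ} (hn : 1 ≤ n) (j : ℕ) :
    criticalPoint k ^ j * heightSum k (n + j) ≤ heightSum k n := by
  induction j with
  | zero => simp
  | succ j ih =>
    have h := heightSum_succ_le hk (show 1 ≤ n + j by omega)
    have h' : criticalPoint k * heightSum k (n + j + 1) ≤ heightSum k (n + j) := by
      rw [criticalPoint, div_mul_eq_mul_div, div_le_iff₀ (by positivity)]
      linarith
    calc criticalPoint k ^ (j + 1) * heightSum k (n + (j + 1))
        = criticalPoint k ^ j * (criticalPoint k * heightSum k (n + j + 1)) := by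
          rw [pow_succ, mul_assoc, add_assoc]
      _ ≤ criticalPoint k ^ j * heightSum k (n + j) :=
          mul_le_mul_of_nonneg_left h' (pow_nonneg (criticalPoint_pos hk).le _)
      _ ≤ _ := ih

/-! ### The generating function of all finite trees -/

/-- The finite trees correspond to the single edge and to the pairs of finite trees. -/
def finiteTreeEquiv : Unit ⊕ {T : PlaneTree // T.IsFinite} × {T : PlaneTree // T.IsFinite} ≃
    {T : PlaneTree // T.IsFinite} :=
  Equiv.ofBijective (fun
    | Sum.inl _ => ⟨edge, isFinite_edge⟩
    | Sum.inr p => ⟨join p.1.1 p.2.1, join_isFinite_iff.2 ⟨p.1.2, p.2.2⟩⟩) (by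
    constructor
    · rintro (⟨⟩ | ⟨⟨L, hL⟩, R, hR⟩) (⟨⟩ | ⟨⟨L', hL'⟩, R', hR'⟩) h
      · rfl
      · exact absurd (congrArg Subtype.val h).symm (join_ne_edge _ _)
      · exact absurd (congrArg Subtype.val h) (join_ne_edge _ _)
      · obtain ⟨rfl, rfl⟩ := join_injective (congrArg Subtype.val h)
        rfl
    · rintro ⟨T, hT⟩
      obtain rfl | ⟨L, R, hL, hR, rfl⟩ := eq_edge_or_join hT
      · exact ⟨Sum.inl (), rfl⟩
      · exact ⟨Sum.inr ⟨⟨L, hL⟩, ⟨R, hR⟩⟩, rfl⟩)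

-- The number `x` is a fixed point of $y\mapsto g+y^2$ with $g=x(1-x)$. By induction on the size
-- bound, the partial sums of the tree series never exceed it.
open Classical in
theorem sum_pow_size_le {x : ℝ} (hx0 : 0 ≤ x) (hx1 : x ≤ 1) (N : ℕ)
    (F : Finset {T : PlaneTree // T.IsFinite}) (hF : ∀ T ∈ F, T.1.size ≤ N) :
    ∑ T ∈ F, (x * (1 - x)) ^ T.1.size ≤ x := by
  have hg : 0 ≤ x * (1 - x) := mul_nonneg hx0 (by linarith)
  induction N generalizing F with
  | zero =>
    have : F = ∅ := by
      rw [Finset.eq_empty_iff_forall_notMem]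
      intro T hT
      have := hF T hT
      have := one_le_size T.2
      omega
    simpa [this] using hx0
  | succ N ih =>
    set w : {T : PlaneTree // T.IsFinite} → ℝ := fun T => (x * (1 - x)) ^ T.1.size with hw
    set P := F.preimage (finiteTreeEquiv ∘ Sum.inr)
      ((finiteTreeEquiv.injective.comp (Sum.inr_injective)).injOn)
    have hP : ∀ p ∈ P, p.1.1.size ≤ N ∧ p.2.1.size ≤ N := by
      intro p hp
      have hp' : finiteTreeEquiv (Sum.inr p) ∈ F := by simpa [P] using hp
      have h1 : (finiteTreeEquiv (Sum.inr p)).1.size ≤ N + 1 := hF _ hp'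
      have h2 : (finiteTreeEquiv (Sum.inr p)).1.size = p.1.1.size + p.2.1.size :=
        size_join p.1.2 p.2.2
      have := one_le_size p.1.2
      have := one_le_size p.2.2
      omega
    -- Both parts of a join have at least one edge, so each part of a tree of size at most `N + 1`
    -- falls under the induction hypothesis.
    have hsub : F ⊆
        insert (finiteTreeEquiv (Sum.inl ())) (P.image (finiteTreeEquiv ∘ Sum.inr)) := by
      intro T hT
      obtain ⟨_ | p, rfl⟩ := finiteTreeEquiv.surjective T
      · exact Finset.mem_insert_self _ _
      · exact Finset.mem_insert_of_mem (Finset.mem_image_of_mem _ (Finset.mem_preimage.2 hT))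
    have hw0 : ∀ T, 0 ≤ w T := fun T => pow_nonneg hg _
    have hedge : w (finiteTreeEquiv (Sum.inl ())) = x * (1 - x) := by
      have : (finiteTreeEquiv (Sum.inl ())).1.size = 1 := size_edge
      simp [hw, this]
    have hjoin : ∀ p, w (finiteTreeEquiv (Sum.inr p)) = w p.1 * w p.2 := by
      intro p
      have : (finiteTreeEquiv (Sum.inr p)).1.size = p.1.1.size + p.2.1.size :=
        size_join p.1.2 p.2.2
      simp [hw, this, pow_add]
    have h1 := ih (P.image Prod.fst) (by
      intro T hT
      obtain ⟨p, hp, rfl⟩ := Finset.mem_image.1 hT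
      exact (hP p hp).1)
    have h2 := ih (P.image Prod.snd) (by
      intro T hT
      obtain ⟨p, hp, rfl⟩ := Finset.mem_image.1 hT
      exact (hP p hp).2)
    calc ∑ T ∈ F, w T
        ≤ ∑ T ∈ insert (finiteTreeEquiv (Sum.inl ())) (P.image (finiteTreeEquiv ∘ Sum.inr)), w T :=
          Finset.sum_le_sum_of_subset_of_nonneg hsub fun _ _ _ => hw0 _
      _ = x * (1 - x) + ∑ p ∈ P, w p.1 * w p.2 := by
          rw [Finset.sum_insert, hedge, Finset.sum_image]
          · simp [hjoin]
          · exact (finiteTreeEquiv.injective.comp (Sum.inr_injective)).injOn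
          · simp
      _ ≤ x * (1 - x) + ∑ p ∈ P.image Prod.fst ×ˢ P.image Prod.snd, w p.1 * w p.2 := by
          refine add_le_add le_rfl ?_
          refine Finset.sum_le_sum_of_subset_of_nonneg (fun p hp => Finset.mem_product.2
            ⟨Finset.mem_image_of_mem _ hp, Finset.mem_image_of_mem _ hp⟩)
            fun p _ _ => mul_nonneg (hw0 _) (hw0 _)
      _ = x * (1 - x) + (∑ T ∈ P.image Prod.fst, w T) * ∑ T ∈ P.image Prod.snd, w T := by
          rw [Finset.sum_mul_sum, Finset.sum_product]
      _ ≤ x * (1 - x) + x * x := by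
          gcongr
      _ = x := by ring

theorem summable_pow_size {x : ℝ} (hx0 : 0 ≤ x) (hx1 : x ≤ 1) :
    Summable fun T : {T : PlaneTree // T.IsFinite} => (x * (1 - x)) ^ T.1.size := by
  have hg : 0 ≤ x * (1 - x) := mul_nonneg hx0 (by linarith)
  exact summable_of_sum_le (fun T => pow_nonneg hg _) fun F =>
    sum_pow_size_le hx0 hx1 (F.sup fun T => T.1.size) F fun T hT =>
      Finset.le_sup (f := fun T : {T : PlaneTree // T.IsFinite} => T.1.size) hT

theorem treeSeries_eq {x : ℝ} (hx0 : 0 ≤ x) (hx1 : x < 1 / 2) : treeSeries (x * (1 - x)) = x := by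
  have hs := summable_pow_size hx0 (by linarith)
  have hg : 0 ≤ x * (1 - x) := mul_nonneg hx0 (by linarith)
  have hle : treeSeries (x * (1 - x)) ≤ x := hs.tsum_le_of_sum_le fun F =>
    sum_pow_size_le hx0 (by linarith) (F.sup fun T => T.1.size) F fun T hT =>
      Finset.le_sup (f := fun T : {T : PlaneTree // T.IsFinite} => T.1.size) hT
  have heq : treeSeries (x * (1 - x)) =
      x * (1 - x) + treeSeries (x * (1 - x)) * treeSeries (x * (1 - x)) := by
    have hprod := hs.mul_of_nonneg hs (fun T => pow_nonneg hg _) (fun T => pow_nonneg hg _)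
    conv_lhs => rw [treeSeries, ← finiteTreeEquiv.tsum_eq]
    have hjoin : ∀ p, (x * (1 - x)) ^ (finiteTreeEquiv (Sum.inr p)).1.size =
        (x * (1 - x)) ^ p.1.1.size * (x * (1 - x)) ^ p.2.1.size := fun p => by
      have : (finiteTreeEquiv (Sum.inr p)).1.size = p.1.1.size + p.2.1.size :=
        size_join p.1.2 p.2.2
      rw [this, pow_add]
    have hedge : (finiteTreeEquiv (Sum.inl ())).1.size = 1 := size_edge
    have hs' := finiteTreeEquiv.summable_iff.2 hs
    refine (Summable.tsum_sum (hs'.comp_injective Sum.inl_injective)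
      (hs'.comp_injective Sum.inr_injective)).trans ?_
    simp only [Function.comp_apply, hjoin, tsum_fintype, Finset.univ_unique, PUnit.default_eq_unit,
      Finset.sum_singleton, hedge, pow_one]
    rw [← hs.tsum_mul_tsum hs hprod, treeSeries]
  -- The quadratic equation $X=g+X^2$ has roots `x` and `1 - x`; the bound `X ≤ x < 1/2` excludes
  -- the larger one.
  nlinarith

/-! ### Grafting trees on the vertices of a level -/

/-- The tree that agrees with `T₀` up to height `r` and whose branch above the edge that leads to
a vertex `u` at height `r` is `f u`. -/
def graft (T₀ : PlaneTree) (r : ℕ) (hr : 1 ≤ r) (f : List ℕ → PlaneTree) : PlaneTree :=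
  ofOffspring (fun v => if v.length < r then T₀.offspring v else
    (f (v.take r)).offspring (0 :: v.drop r)) (by
      rw [List.length_nil, if_pos (by omega), offspring_nil])

section Graft

variable {T₀ : PlaneTree} {r : ℕ} {hr : 1 ≤ r} {f : List ℕ → PlaneTree}

theorem ballVerts_graft : (graft T₀ r hr f).ballVerts r = T₀.ballVerts r := by
  refine ((ballVerts_eq_iff _ _ _).2 fun v hv hvr => ?_).symm
  rw [graft, mem_ofOffspring] at hv
  rw [graft, offspring_ofOffspring hv, if_pos hvr]

theorem mem_graft_of_length_le {w : List ℕ} (hw : w.length ≤ r) :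
    w ∈ (graft T₀ r hr f).carrier ↔ w ∈ T₀.carrier := by
  have := Set.ext_iff.1 (ballVerts_graft (T₀ := T₀) (hr := hr) (f := f)) w
  simpa [ballVerts, hw] using this

/-- The root edge of `f u` is identified with the edge leading to `u`, so its vertex `[0]` becomes
`u`. This explains why `size_graft` adds only the inner vertices and why `le_height_graft` has `r -
1`. -/
theorem mem_graft_append {u w : List ℕ} (hu : u.length = r) :
    u ++ w ∈ (graft T₀ r hr f).carrier ↔ u ∈ T₀.carrier ∧ 0 :: w ∈ (f u).carrier := by
  rw [← mem_graft_of_length_le (f := f) (hr := hr) hu.le]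
  rw [graft, mem_ofOffspring, mem_ofOffspring, inTree_append, mem_iff_inTree (f u)]
  refine and_congr_right fun _ => ?_
  simp [hu, offspring_nil]

theorem graft_verts : (graft T₀ r hr f).carrier \ {[]} = ↑(T₀.innerVerts r) ∪
    ⋃ u ∈ T₀.levelFinset r, (fun w => u ++ w) '' {w | 0 :: w ∈ (f u).carrier} := by
  ext v
  simp only [Set.mem_sdiff, Set.mem_singleton_iff, Set.mem_union, Finset.mem_coe, mem_innerVerts,
    Set.mem_iUnion, mem_levelFinset, Set.mem_image, Set.mem_ofPred_eq, exists_prop]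
  constructor
  · rintro ⟨hv, hne⟩
    by_cases hvr : v.length < r
    · exact Or.inl ⟨(mem_graft_of_length_le hvr.le).1 hv, List.length_pos_of_ne_nil hne, hvr⟩
    · rw [← List.take_append_drop r v] at hv
      have hl : (v.take r).length = r := by simp; omega
      rw [mem_graft_append hl] at hv
      exact Or.inr ⟨_, ⟨hv.1, hl⟩, _, hv.2, List.take_append_drop r v⟩
  · rintro (⟨hv, h1, h2⟩ | ⟨u, ⟨hu, hl⟩, w, hw, rfl⟩)
    · refine ⟨(mem_graft_of_length_le h2.le).2 hv, ?_⟩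
      rintro rfl
      simp at h1
    · refine ⟨(mem_graft_append hl).2 ⟨hu, hw⟩, fun h => ?_⟩
      simp only [List.append_eq_nil_iff] at h
      rw [h.1, List.length_nil] at hl
      omega

theorem graft_isFinite (hf : ∀ u ∈ T₀.levelFinset r, (f u).IsFinite) :
    (graft T₀ r hr f).IsFinite := by
  have h : ((graft T₀ r hr f).carrier \ {[]}).Finite := by
    rw [graft_verts]
    refine (Finset.finite_toSet _).union ?_
    exact (Finset.finite_toSet (T₀.levelFinset r)).biUnion fun u hu =>
      ((isFinite_iff _).1 (hf u hu)).image _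
  refine (h.insert []).subset fun w hw => ?_
  by_cases h : w = []
  · exact Or.inl h
  · exact Or.inr ⟨hw, h⟩

theorem size_graft (hf : ∀ u ∈ T₀.levelFinset r, (f u).IsFinite) :
    (graft T₀ r hr f).size = (T₀.innerVerts r).card + ∑ u ∈ T₀.levelFinset r, (f u).size := by
  have hfin : ∀ u ∈ T₀.levelFinset r,
      ((fun w => u ++ w) '' {w | 0 :: w ∈ (f u).carrier}).Finite := fun u hu =>
    ((isFinite_iff _).1 (hf u hu)).image _
  have hbu : (⋃ u ∈ T₀.levelFinset r, (fun w => u ++ w) '' {w | 0 :: w ∈ (f u).carrier}).Finite :=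
    (Finset.finite_toSet (T₀.levelFinset r)).biUnion hfin
  rw [size, graft_verts, Set.ncard_union_eq ?_ (Finset.finite_toSet _) hbu, Set.ncard_coe_finset]
  · congr 1
    have := (Finset.finite_toSet (T₀.levelFinset r)).ncard_biUnion (s := fun u =>
      (fun w => u ++ w) '' {w | 0 :: w ∈ (f u).carrier}) hfin ?_
    · simp only [Finset.mem_coe] at this
      rw [this]
      refine (finsum_mem_coe_finset _ _).trans (Finset.sum_congr rfl fun u _ => ?_)
      rw [Set.ncard_image_of_injective _ (List.append_right_injective u), size_eq]
    · intro u hu v hv huv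
      rw [Function.onFun, Set.disjoint_left]
      rintro _ ⟨w, -, rfl⟩ ⟨w', -, h⟩
      rw [Finset.mem_coe, mem_levelFinset] at hu hv
      exact huv (List.append_inj_left h (hv.2.trans hu.2.symm)).symm
  · rw [Set.disjoint_left]
    intro v hv hv'
    simp only [Finset.mem_coe, mem_innerVerts] at hv
    simp only [Set.mem_iUnion, mem_levelFinset, Set.mem_image, exists_prop] at hv'
    obtain ⟨u, ⟨-, hu⟩, w, -, rfl⟩ := hv'
    simp at hv
    omega

theorem le_height_graft (hf : ∀ u ∈ T₀.levelFinset r, (f u).IsFinite) {u : List ℕ}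
    (hu : u ∈ T₀.levelFinset r) : (r - 1) + (f u).height ≤ (graft T₀ r hr f).height := by
  obtain ⟨w, hw, hl⟩ := exists_length_eq_height (hf u hu)
  have h1 := one_le_height (hf u hu)
  rw [mem_levelFinset] at hu
  rcases w with _ | ⟨i, w⟩
  · simp at hl; omega
  have := head_eq_zero hw
  subst this
  have := length_le_height (graft_isFinite hf) ((mem_graft_append (hr := hr) hu.2).2 ⟨hu.1, hw⟩)
  simp at this hl
  omega

theorem graft_injective {f' : List ℕ → PlaneTree} (h : graft T₀ r hr f = graft T₀ r hr f')
    {u : List ℕ} (hu : u ∈ T₀.levelFinset r) : f u = f' u := by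
  rw [mem_levelFinset] at hu
  refine ext_cons fun w => ?_
  have h1 := mem_graft_append (T₀ := T₀) (hr := hr) (f := f) (w := w) hu.2
  rw [h, mem_graft_append hu.2] at h1
  simpa [hu.1] using h1.symm

end Graft

/-- If the balls of radius `r` differ, all common radii are at most `r - 1`, so the distance is at
least `1 / (r - 1)`, strictly above `1 / r`. For `r = 1` all trees agree. -/
theorem mem_closedBall_iff {T T' : PlaneTree} {r : ℕ} (hr : 1 ≤ r) :
    T ∈ Metric.closedBall T' (1 / (r : ℝ)) ↔ T.ballVerts r = T'.ballVerts r := by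
  rw [Metric.mem_closedBall]
  constructor
  · intro h
    by_contra hne
    have hr2 : 2 ≤ r := by
      by_contra hr2
      obtain rfl : r = 1 := by omega
      exact hne (by rw [ballVerts_one, ballVerts_one])
    have hr1 : (1 : ℝ) ≤ ((r - 1 : ℕ) : ℝ) := by exact_mod_cast (show 1 ≤ r - 1 by omega)
    have hrr : (r : ℝ) = ((r - 1 : ℕ) : ℝ) + 1 := by exact_mod_cast (show r = r - 1 + 1 by omega)
    have h2 : 1 / ((r - 1 : ℕ) : ℝ) ≤ dist T T' := by
      refine le_csInf (commonRadii_nonempty T T') ?_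
      rintro a ⟨s, hs, hsT, rfl⟩
      have hs' : s ≤ r - 1 := by
        by_contra hlt
        exact hne (ballVerts_mono_eq hsT (by omega))
      exact one_div_le_one_div_of_le (by exact_mod_cast hs) (by exact_mod_cast hs')
    have h3 := one_div_lt_one_div_of_lt (show (0 : ℝ) < ((r - 1 : ℕ) : ℝ) by linarith)
      (show ((r - 1 : ℕ) : ℝ) < r by linarith)
    linarith
  · intro h
    exact csInf_le (commonRadii_bddBelow T T') ⟨r, hr, h, rfl⟩

/-! ### The finite size measures of balls -/

/-- The finite trees of size at most `M`. -/
def smallTrees (M : ℕ) : Finset PlaneTree :=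
  ((Finset.range (M + 1)).finite_toSet.biUnion fun n _ => finite_setOf_size n).toFinset

theorem mem_smallTrees {T : PlaneTree} {M : ℕ} :
    T ∈ smallTrees M ↔ T.IsFinite ∧ T.size ≤ M := by
  simp [smallTrees]

-- The left side counts only trees with one large branch above level `r` and all other branches of
-- size at most `M`. The bound on `N` makes the large branch bigger than `M`, so it is recognisable
-- and nothing is counted twice.
open Classical in
theorem heightSum_mul_le {k : ℝ} (hk : 1 < k) {T₀ : PlaneTree} {r : ℕ} (hr : 1 ≤ r) (M N : ℕ)
    (hN : (T₀.innerVerts r).card + ((T₀.levelFinset r).card + 1) * (M + 1) < N) :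
    heightSum k N * ((T₀.levelFinset r).card * k ^ (r - 1) *
      criticalPoint k ^ (T₀.innerVerts r).card *
      (∑ T ∈ smallTrees M, criticalPoint k ^ T.size) ^ ((T₀.levelFinset r).card - 1)) ≤
    ∑ T ∈ treesOfSize N with T ∈ Metric.closedBall T₀ (1 / (r : ℝ)), k ^ T.height := by
  set K := T₀.levelFinset r with hK
  set I := (T₀.innerVerts r).card
  set g := criticalPoint k
  have hg : 0 < g := criticalPoint_pos (by linarith)
  let t : K → K → Finset PlaneTree := fun i j => if j = i then {edge} else smallTrees M
  let s : (i : K) → (K → PlaneTree) → ℕ := fun i F => ∑ j ∈ Finset.univ.erase i, (F j).size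
  let ext : (K → PlaneTree) → List ℕ → PlaneTree := fun F u => if h : u ∈ K then F ⟨u, h⟩ else edge
  have ht : ∀ i F, F ∈ Fintype.piFinset (t i) →
      F i = edge ∧ ∀ j, j ≠ i → (F j).IsFinite ∧ (F j).size ≤ M := by
    intro i F hF
    rw [Fintype.mem_piFinset] at hF
    refine ⟨by simpa [t] using hF i, fun j hj => ?_⟩
    simpa [t, hj, mem_smallTrees] using hF j
  have hs : ∀ i F, F ∈ Fintype.piFinset (t i) → s i F ≤ K.card * M := by
    intro i F hF
    refine (Finset.sum_le_card_nsmul _ _ M fun j hj =>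
      ((ht i F hF).2 j (Finset.ne_of_mem_erase hj)).2).trans ?_
    rw [smul_eq_mul]
    refine Nat.mul_le_mul_right _ ((Finset.card_le_card (Finset.erase_subset _ _)).trans_eq ?_)
    simp
  have hbig : ∀ i F, F ∈ Fintype.piFinset (t i) → I + s i F + M < N := by
    intro i F hF
    have := hs i F hF
    nlinarith
  have hfin : ∀ i F, F ∈ Fintype.piFinset (t i) → ∀ T : PlaneTree, T.IsFinite →
      ∀ j, (Function.update F i T j).IsFinite := by
    intro i F hF T hT j
    by_cases hj : j = i
    · subst hj; simpa using hT
    · simpa [hj] using ((ht i F hF).2 j hj).1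
  have hext : ∀ F (u : K), ext F u = F u := fun F u => by simp [ext]
  have hextfin : ∀ F : K → PlaneTree, (∀ j, (F j).IsFinite) → ∀ u ∈ K, (ext F u).IsFinite := by
    intro F hF u hu
    rw [hext F ⟨u, hu⟩]
    exact hF _
  have hsize : ∀ i F, F ∈ Fintype.piFinset (t i) → ∀ T : PlaneTree, T.IsFinite →
      (graft T₀ r hr (ext (Function.update F i T))).size = I + (s i F + T.size) := by
    intro i F hF T hT
    rw [size_graft (hextfin _ (hfin i F hF T hT)), ← hK, ← Finset.sum_coe_sort]
    simp_rw [hext]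
    rw [← Finset.sum_erase_add _ _ (Finset.mem_univ i), Function.update_self]
    congr 2
    exact Finset.sum_congr rfl fun j hj => by
      rw [Function.update_of_ne (Finset.ne_of_mem_erase hj)]
  let A : Finset (Σ _ : K, Σ _ : K → PlaneTree, PlaneTree) :=
    Finset.univ.sigma fun i => (Fintype.piFinset (t i)).sigma fun F =>
      treesOfSize (N - I - s i F)
  let φ : (Σ _ : K, Σ _ : K → PlaneTree, PlaneTree) → PlaneTree := fun x =>
    graft T₀ r hr (ext (Function.update x.2.1 x.1 x.2.2))
  have hA : ∀ x, x ∈ A → x.2.1 ∈ Fintype.piFinset (t x.1) ∧ x.2.2.IsFinite ∧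
      x.2.2.size = N - I - s x.1 x.2.1 := by
    intro x hx
    simpa [A, mem_treesOfSize] using hx
  have hinj : Set.InjOn φ A := by
    rintro ⟨i, F, T⟩ hx ⟨i', F', T'⟩ hx' h
    obtain ⟨hF, hT, hTs⟩ := hA _ hx
    obtain ⟨hF', hT', hTs'⟩ := hA _ hx'
    simp only at hF hT hTs hF' hT' hTs'
    have hu : ∀ j, Function.update F i T j = Function.update F' i' T' j := fun j =>
      (hext _ j).symm.trans ((graft_injective h j.2).trans (hext _ j))
    have hbF := hbig i F hF
    -- If the positions differed, the large branch of one description would be a small branch of the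
    -- other, against `hbF`.
    have hii : i = i' := by
      by_contra hne
      have h1 := hu i
      rw [Function.update_self, Function.update_of_ne hne] at h1
      have h2 := ((ht i' F' hF').2 i hne).2
      rw [← h1] at h2
      omega
    subst hii
    have hTT : T = T' := by simpa using hu i
    subst hTT
    have hFF : F = F' := by
      funext j
      by_cases hj : j = i
      · subst hj; rw [(ht j F hF).1, (ht j F' hF').1]
      · simpa [hj] using hu j
    subst hFF
    rfl
  have hmaps : A.image φ ⊆
      {T ∈ treesOfSize N | T ∈ Metric.closedBall T₀ (1 / (r : ℝ))} := by
    intro T hT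
    obtain ⟨x, hx, rfl⟩ := Finset.mem_image.1 hT
    obtain ⟨hF, hT, hTs⟩ := hA _ hx
    rw [Finset.mem_filter, mem_treesOfSize, mem_closedBall_iff hr]
    refine ⟨⟨graft_isFinite (hextfin _ (hfin _ _ hF _ hT)), ?_⟩, ballVerts_graft⟩
    rw [hsize _ _ hF _ hT, hTs]
    have := hbig _ _ hF
    omega
  have hheight : ∀ x ∈ A, k ^ (r - 1) * k ^ x.2.2.height ≤ k ^ (φ x).height := by
    intro x hx
    obtain ⟨hF, hT, hTs⟩ := hA _ hx
    rw [← pow_add]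
    refine pow_le_pow_right₀ hk.le ?_
    have := le_height_graft (hr := hr) (hextfin _ (hfin _ _ hF _ hT)) x.1.2
    rwa [hext, Function.update_self] at this
  calc _ = ∑ i : K, k ^ (r - 1) * g ^ I * heightSum k N *
        ∑ F ∈ Fintype.piFinset (t i), g ^ (s i F) := by
        have hsum : ∀ i : K, ∑ F ∈ Fintype.piFinset (t i), g ^ (s i F) =
            (∑ T ∈ smallTrees M, g ^ T.size) ^ (K.card - 1) := by
          intro i
          have h1 := Finset.prod_univ_sum (t i) (fun j T => if j = i then 1 else g ^ T.size)
          have h2 : ∀ F : K → PlaneTree,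
              ∏ j, (if j = i then 1 else g ^ (F j).size) = g ^ (s i F) := by
            intro F
            rw [← Finset.mul_prod_erase _ _ (Finset.mem_univ i), if_pos rfl, one_mul,
              ← Finset.prod_pow_eq_pow_sum]
            exact Finset.prod_congr rfl fun j hj => if_neg (Finset.ne_of_mem_erase hj)
          simp_rw [h2] at h1
          rw [← h1, ← Finset.mul_prod_erase _ _ (Finset.mem_univ i)]
          rw [Finset.prod_congr rfl (g := fun _ => ∑ T ∈ smallTrees M, g ^ T.size) (fun j hj => by
            simp [t, Finset.ne_of_mem_erase hj])]
          simp [t, Finset.prod_const, Finset.card_erase_of_mem]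
        simp_rw [hsum]
        rw [Finset.sum_const, Finset.card_univ, Fintype.card_coe, nsmul_eq_mul]
        ring
    _ ≤ ∑ i : K, ∑ F ∈ Fintype.piFinset (t i), ∑ T ∈ treesOfSize (N - I - s i F),
        k ^ (r - 1) * k ^ T.height := by
        refine Finset.sum_le_sum fun i _ => ?_
        rw [Finset.mul_sum]
        refine Finset.sum_le_sum fun F hF => ?_
        rw [← Finset.mul_sum, mul_assoc, mul_assoc]
        refine mul_le_mul_of_nonneg_left ?_ (by positivity)
        have hb := hbig i F hF
        -- The large branch has `I + s i F` edges fewer than the whole tree, and each missing edge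
        -- costs a factor of at most `g`.
        have := criticalPoint_pow_mul_heightSum_le (show 0 < k by linarith)
          (show 1 ≤ N - I - s i F by omega) (I + s i F)
        rw [show N - I - s i F + (I + s i F) = N by omega, pow_add] at this
        calc g ^ I * (heightSum k N * g ^ s i F) = g ^ I * g ^ s i F * heightSum k N := by ring
          _ ≤ _ := this
    _ = ∑ x ∈ A, k ^ (r - 1) * k ^ x.2.2.height := by
        rw [Finset.sum_sigma]
        refine Finset.sum_congr rfl fun i _ => ?_
        rw [Finset.sum_sigma]
    _ ≤ ∑ x ∈ A, k ^ (φ x).height := Finset.sum_le_sum hheight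
    _ = ∑ T ∈ A.image φ, k ^ T.height := 
        (Finset.sum_image (f := fun T : PlaneTree => k ^ T.height) hinj).symm
    _ ≤ _ := Finset.sum_le_sum_of_subset_of_nonneg hmaps fun _ _ _ => by positivity

/-! ### The offspring probabilities -/

theorem criticalPoint_eq {k : ℝ} (hk : 0 < k) :
    criticalPoint k = 1 / (1 + k) * (1 - 1 / (1 + k)) := by
  rw [criticalPoint]
  field_simp
  ring

theorem treeSeries_criticalPoint {k : ℝ} (hk : 1 < k) :
    treeSeries (criticalPoint k) = 1 / (1 + k) := by
  rw [criticalPoint_eq (by linarith)]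
  refine treeSeries_eq (by positivity) ?_
  rw [div_lt_div_iff₀] <;> linarith

theorem summable_criticalPoint {k : ℝ} (hk : 0 < k) :
    Summable fun T : {T : PlaneTree // T.IsFinite} => criticalPoint k ^ T.1.size := by
  rw [criticalPoint_eq hk]
  refine summable_pow_size (by positivity) ?_
  rw [div_le_one] <;> linarith

theorem branchingProb_eq {k : ℝ} (hk : 1 < k) (n : ℕ) :
    branchingProb k n = (1 / (1 + k)) ^ n * (1 - 1 / (1 + k)) := by
  rw [branchingProb, treeSeries_criticalPoint hk]

theorem hasSum_mean_branchingProb {k : ℝ} (hk : 1 < k) :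
    HasSum (fun n : ℕ => (n : ℝ) * branchingProb k n) (1 / k) := by
  have h1 : ‖1 / (1 + k)‖ < 1 := by
    rw [Real.norm_of_nonneg (by positivity), div_lt_one] <;> linarith
  convert! (hasSum_coe_mul_geometric_of_norm_lt_one h1).mul_right (1 - 1 / (1 + k)) using 1
  · funext n
    rw [branchingProb_eq hk, mul_assoc]
  · have hk0 : k ≠ 0 := by linarith
    have hk1 : 1 + k ≠ 0 := by linarith
    rw [show 1 - 1 / (1 + k) = k / (1 + k) by field_simp; ring]
    field_simp

theorem meanOffspring_branchingProb {k : ℝ} (hk : 1 < k) :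
    meanOffspring (branchingProb k) = 1 / k := (hasSum_mean_branchingProb hk).tsum_eq

theorem branchingProb_nonneg {k : ℝ} (hk : 1 < k) (n : ℕ) : 0 ≤ branchingProb k n := by
  rw [branchingProb_eq hk]
  have : 1 / (1 + k) ≤ 1 := by rw [div_le_one] <;> linarith
  exact mul_nonneg (by positivity) (by linarith)

theorem hasSum_branchingProb {k : ℝ} (hk : 1 < k) : HasSum (branchingProb k) 1 := by
  have h1 : 1 / (1 + k) < 1 := by rw [div_lt_one] <;> linarith
  have := (hasSum_geometric_of_lt_one (by positivity) h1).mul_right (1 - 1 / (1 + k))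
  rw [inv_mul_cancel₀ (by linarith)] at this
  convert! this using 1
  funext n
  exact branchingProb_eq hk n

theorem isSubcritical_branchingProb {k : ℝ} (hk : 1 < k) : IsSubcritical (branchingProb k) where
  nonneg := branchingProb_nonneg hk
  hasSum_one := hasSum_branchingProb hk
  summable_mean := (hasSum_mean_branchingProb hk).summable
  mean_lt_one := by
    rw [meanOffspring_branchingProb hk, div_lt_one] <;> linarith

/-- The mean is `1 / k`, so size biasing costs exactly one factor `k` per special vertex. -/
theorem specialProb_branchingProb {k : ℝ} (hk : 1 < k) (n : ℕ) :
    specialProb (branchingProb k) n = k * branchingProb k (n + 1) := by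
  rw [specialProb, sizeBiased, meanOffspring_branchingProb hk]
  have : (n : ℝ) + 1 ≠ 0 := by positivity
  field_simp

/-! ### The weights of the balls -/

theorem sum_offspring_level (T : PlaneTree) (s : ℕ) :
    ∑ v ∈ T.levelFinset s, T.offspring v = (T.levelFinset (s + 1)).card := by
  have : ∑ v ∈ T.levelFinset s, T.offspring v =
      ∑ v ∈ T.levelFinset s, (Finset.range (T.offspring v)).card := by simp
  rw [this, ← Finset.card_sigma]
  refine Finset.card_bij (fun x _ => x.1 ++ [x.2]) ?_ ?_ ?_
  · rintro ⟨v, i⟩ h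
    simp only [Finset.mem_sigma, mem_levelFinset, Finset.mem_range] at h ⊢
    exact ⟨(append_singleton_mem_iff T v i).2 h.2, by simp [h.1.2]⟩
  · rintro ⟨v, i⟩ _ ⟨v', i'⟩ _ h
    simp only [List.append_singleton_inj] at h
    obtain ⟨rfl, rfl⟩ := h
    rfl
  · intro w hw
    rw [mem_levelFinset] at hw
    rcases List.eq_nil_or_concat' w with rfl | ⟨u, i, rfl⟩
    · simp at hw
    · refine ⟨⟨u, i⟩, ?_, rfl⟩
      simp only [Finset.mem_sigma, mem_levelFinset, Finset.mem_range]
      exact ⟨⟨T.parent_mem u i hw.1, by simpa using hw.2⟩,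
        (append_singleton_mem_iff T u i).1 hw.1⟩

theorem card_level_one (T : PlaneTree) : (T.levelFinset 1).card = 1 := by
  rw [Finset.card_eq_one]
  refine ⟨[0], ?_⟩
  ext u
  rw [mem_levelFinset, Finset.mem_singleton]
  constructor
  · rintro ⟨h, hl⟩
    obtain ⟨j, rfl⟩ := List.length_eq_one_iff.1 hl
    rw [head_eq_zero h]
  · rintro rfl
    exact ⟨T.zero_mem, rfl⟩

/-- Each vertex at heights `2, …, r` is counted once through its parent; the `1` is the vertex at
height one. -/
theorem sum_offspring_innerVerts (T : PlaneTree) {r : ℕ} (hr : 1 ≤ r) :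
    ∑ v ∈ T.innerVerts r, T.offspring v + 1 = (T.innerVerts r).card + (T.levelFinset r).card := by
  induction r, hr using Nat.le_induction with
  | base => simp [innerVerts, card_level_one]
  | succ r hr ih =>
    have hu : T.innerVerts (r + 1) = T.innerVerts r ∪ T.levelFinset r := by
      ext u
      rw [Finset.mem_union, mem_innerVerts, mem_innerVerts, mem_levelFinset]
      constructor
      · rintro ⟨h, h1, h2⟩
        by_cases h3 : u.length < r
        · exact Or.inl ⟨h, h1, h3⟩
        · exact Or.inr ⟨h, by omega⟩
      · rintro (⟨h, h1, h2⟩ | ⟨h, h1⟩)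
        · exact ⟨h, h1, by omega⟩
        · exact ⟨h, by omega⟩
    have hd : Disjoint (T.innerVerts r) (T.levelFinset r) := by
      rw [Finset.disjoint_left]
      intro u h1 h2
      rw [mem_innerVerts] at h1
      rw [mem_levelFinset] at h2
      omega
    rw [hu, Finset.sum_union hd, Finset.card_union_of_disjoint hd, sum_offspring_level]
    omega

theorem innerVerts_filter_prefix {T : PlaneTree} {r : ℕ} {i : List ℕ}
    (hi : i ∈ T.levelFinset r) :
    {v ∈ T.innerVerts r | v <+: i} = (Finset.Ico 1 r).image (fun s => i.take s) := by
  rw [mem_levelFinset] at hi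
  ext v
  simp only [Finset.mem_filter, mem_innerVerts, Finset.mem_image, Finset.mem_Ico]
  constructor
  · rintro ⟨⟨h, h1, h2⟩, h3⟩
    exact ⟨v.length, ⟨h1, h2⟩, (List.prefix_iff_eq_take.1 h3).symm⟩
  · rintro ⟨s, ⟨h1, h2⟩, rfl⟩
    refine ⟨⟨T.prefix_mem _ (i.drop s) (by simpa using hi.1), ?_, ?_⟩, List.take_prefix _ _⟩
    · simp; omega
    · simp; omega

theorem card_innerVerts_prefix {T : PlaneTree} {r : ℕ} {i : List ℕ}
    (hi : i ∈ T.levelFinset r) : {v ∈ T.innerVerts r | v <+: i}.card = r - 1 := by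
  rw [innerVerts_filter_prefix hi, Finset.card_image_of_injOn, Nat.card_Ico]
  rw [mem_levelFinset] at hi
  intro a ha b hb h
  have := congrArg List.length h
  simp at this ha hb
  omega

/-- A proper prefix of a word continues by one of its letters. -/
theorem exists_append_singleton_prefix {v i : List ℕ} (h : v <+: i) (hl : v.length < i.length) :
    ∃ j, v ++ [j] <+: i := by
  obtain ⟨w, rfl⟩ := h
  rcases w with _ | ⟨j, w⟩
  · simp at hl
  · exact ⟨j, w, by simp⟩

theorem mem_of_prefix (T : PlaneTree) {u w : List ℕ} (h : u <+: w) (hw : w ∈ T.carrier) :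
    u ∈ T.carrier := by
  obtain ⟨t, rfl⟩ := h
  exact T.prefix_mem u t hw

/-- The `r - 1` special vertices contribute a factor `k` each, so the weight does not depend on the
chosen path. -/
theorem markedWeight_eq {k : ℝ} (hk : 1 < k) {T₀ : PlaneTree} {i : List ℕ}
    (hi : i ∈ T₀.levelFinset T₀.height) :
    markedWeight (branchingProb k) T₀ i =
      k ^ (T₀.height - 1) * ∏ v ∈ T₀.innerVerts T₀.height, branchingProb k (T₀.offspring v) := by
  have h1 : ∏ v ∈ T₀.innerVerts T₀.height with v <+: i,
      specialProb (branchingProb k) (T₀.offspring v - 1) =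
      ∏ v ∈ T₀.innerVerts T₀.height with v <+: i, k * branchingProb k (T₀.offspring v) := by
    refine Finset.prod_congr rfl fun v hv => ?_
    rw [Finset.mem_filter, mem_innerVerts] at hv
    rw [mem_levelFinset] at hi
    -- A vertex on the path has an offspring, which makes the natural subtraction in `offspring - 1`
    -- exact.
    obtain ⟨j, hj⟩ := exists_append_singleton_prefix hv.2 (by omega)
    have := (append_singleton_mem_iff T₀ v j).1 (T₀.mem_of_prefix hj hi.1)
    rw [specialProb_branchingProb hk, Nat.sub_add_cancel (by omega)]
  rw [markedWeight, h1, Finset.prod_mul_distrib, Finset.prod_const, card_innerVerts_prefix hi,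
    ← Finset.prod_filter_mul_prod_filter_not (T₀.innerVerts T₀.height) (fun v => v <+: i)]
  ring

theorem card_level_height_pos {T₀ : PlaneTree} (hf : T₀.IsFinite) :
    1 ≤ (T₀.levelFinset T₀.height).card := by
  obtain ⟨w, hw, hl⟩ := exists_length_eq_height hf
  exact Finset.card_pos.2 ⟨w, mem_levelFinset.2 ⟨hw, hl⟩⟩

/-- With $x=X(g_c)$ and $g_c=x(1-x)$, the identity `sum_offspring_innerVerts` turns $\prod p$ into
$g_c^I x^{K-1}$. This is the constant of `heightSum_mul_le` as $M\to\infty$. -/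
theorem sum_markedWeight {k : ℝ} (hk : 1 < k) {T₀ : PlaneTree} (hf : T₀.IsFinite) :
    ∑ i ∈ T₀.levelFinset T₀.height, markedWeight (branchingProb k) T₀ i =
      (T₀.levelFinset T₀.height).card * k ^ (T₀.height - 1) *
        criticalPoint k ^ (T₀.innerVerts T₀.height).card *
        treeSeries (criticalPoint k) ^ ((T₀.levelFinset T₀.height).card - 1) := by
  rw [Finset.sum_congr rfl fun i hi => markedWeight_eq hk hi, Finset.sum_const, nsmul_eq_mul]
  simp_rw [branchingProb_eq hk]
  rw [Finset.prod_mul_distrib, Finset.prod_const, Finset.prod_pow_eq_pow_sum,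
    treeSeries_criticalPoint hk, criticalPoint_eq (by linarith), mul_pow]
  have h1 := T₀.sum_offspring_innerVerts (one_le_height hf)
  have h2 := card_level_height_pos hf
  rw [show ∑ v ∈ T₀.innerVerts T₀.height, T₀.offspring v =
    (T₀.innerVerts T₀.height).card + ((T₀.levelFinset T₀.height).card - 1) by omega, pow_add]
  ring

/-! ### The limit of the finite size measures -/

theorem finiteSizeMeasure_closedBall {μ k : ℝ} (hk : k = Real.exp (-μ)) (N : ℕ) (T₀ : PlaneTree)
    (a : ℝ) [DecidablePred fun T => T ∈ Metric.closedBall T₀ a] :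
    finiteSizeMeasure μ N (Metric.closedBall T₀ a) =
      ENNReal.ofReal ((∑ T ∈ treesOfSize N with T ∈ Metric.closedBall T₀ a, k ^ T.height) /
        heightSum k N) := by
  have hk0 : 0 < k := hk ▸ Real.exp_pos _
  have hZ : 0 ≤ heightSum k N := Finset.sum_nonneg fun _ _ => by positivity
  rw [Finset.sum_div, ENNReal.ofReal_sum_of_nonneg (fun T _ => by positivity),
    Finset.sum_filter, finiteSizeMeasure, Measure.coe_finsetSum, Finset.sum_apply]
  refine Finset.sum_congr rfl fun T _ => ?_
  rw [Measure.smul_apply, Measure.dirac_apply' _ Metric.isClosed_closedBall.measurableSet,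
    partitionFunction_eq, ← hk]
  by_cases h : T ∈ Metric.closedBall T₀ a
  · rw [Set.indicator_of_mem h, if_pos h, hk, ← Real.exp_nat_mul, mul_comm (-μ)]
    simp
  · rw [Set.indicator_of_notMem h, if_neg h]
    simp

theorem tendsto_sum_smallTrees {x : ℝ}
    (hs : Summable fun T : {T : PlaneTree // T.IsFinite} => x ^ T.1.size) :
    Tendsto (fun M => ∑ T ∈ smallTrees M, x ^ T.size) atTop (𝓝 (treeSeries x)) := by
  classical
  have h1 : Tendsto (fun M => (smallTrees M).subtype IsFinite) atTop atTop := by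
    refine tendsto_atTop_finset_of_monotone ?_ ?_
    · intro M M' h T hT
      rw [Finset.mem_subtype, mem_smallTrees] at hT ⊢
      exact ⟨hT.1, hT.2.trans h⟩
    · intro T
      exact ⟨T.1.size, by rw [Finset.mem_subtype, mem_smallTrees]; exact ⟨T.2, le_rfl⟩⟩
  refine (hs.hasSum.comp h1).congr fun M => ?_
  exact Finset.sum_subtype_of_mem (fun T : PlaneTree => x ^ T.size)
    fun T hT => (mem_smallTrees.1 hT).1

theorem ofReal_sum_markedWeight_le_liminf {μ k : ℝ} (hk1 : 1 < k) (hk : k = Real.exp (-μ))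
    {T₀ : PlaneTree} (hf : T₀.IsFinite) :
    ENNReal.ofReal (∑ i ∈ T₀.levelFinset T₀.height, markedWeight (branchingProb k) T₀ i) ≤
      liminf (fun N : ℕ+ => finiteSizeMeasure μ N
        (Metric.closedBall T₀ (1 / (T₀.height : ℝ)))) atTop := by
  classical
  have hk0 : 0 < k := by linarith
  rw [sum_markedWeight hk1 hf]
  have ht := tendsto_sum_smallTrees (summable_criticalPoint hk0)
  refine le_of_tendsto' (ENNReal.tendsto_ofReal ((ht.pow _).const_mul _)) fun M => ?_
  refine le_liminf_of_le (by isBoundedDefault) ?_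
  filter_upwards [eventually_ge_atTop (⟨(T₀.innerVerts T₀.height).card +
    ((T₀.levelFinset T₀.height).card + 1) * (M + 1) + 1, by positivity⟩ : ℕ+)] with N hN
  rw [finiteSizeMeasure_closedBall hk]
  refine ENNReal.ofReal_le_ofReal ?_
  rw [le_div_iff₀ (heightSum_pos hk0 N.pos), mul_comm]
  exact heightSum_mul_le hk1 (one_le_height hf) M N hN

/-! ### Decomposition of open sets into balls around finite trees, and the weak limit -/

theorem exists_length_eq {T : PlaneTree} (hT : ¬ T.IsFinite) (r : ℕ) :
    ∃ u ∈ T.carrier, u.length = r := by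
  by_contra! hcon
  refine hT (((Finset.range r).finite_toSet.biUnion fun s _ => T.level_finite s).subset ?_)
  intro u hu
  simp only [Finset.coe_range, Set.mem_Iio, Set.mem_iUnion, exists_prop]
  refine ⟨u.length, ?_, hu, rfl⟩
  by_contra hlt
  refine hcon (u.take r) (T.mem_of_prefix (List.take_prefix _ _) hu) ?_
  simp
  omega

/-- Levels are finite, so an infinite tree reaches height `r`. Grafting single edges at level `r`
adds nothing above it and thus cuts the tree there. -/
theorem exists_truncation {T : PlaneTree} (hT : ¬ T.IsFinite) {r : ℕ} (hr : 1 ≤ r) :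
    ∃ T₀ : PlaneTree, T₀.IsFinite ∧ T₀.height = r ∧ T₀.ballVerts r = T.ballVerts r := by
  have hf : (graft T r hr fun _ => edge).IsFinite := graft_isFinite fun _ _ => isFinite_edge
  refine ⟨_, hf, le_antisymm ((height_le_iff hf).2 fun w hw => ?_) ?_, ballVerts_graft⟩
  · by_contra! hlt
    have hl : (w.take r).length = r := by simp; omega
    rw [← List.take_append_drop r w, mem_graft_append hl] at hw
    have := length_le_height isFinite_edge hw.2
    rw [height_edge] at this
    simp at this
    omega
  · obtain ⟨u, hu, rfl⟩ := exists_length_eq hT r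
    exact length_le_height hf ((mem_graft_of_length_le le_rfl).2 hu)

theorem closedBall_congr {T T' : PlaneTree} {r : ℕ} (hr : 1 ≤ r)
    (h : T.ballVerts r = T'.ballVerts r) :
    Metric.closedBall T (1 / (r : ℝ)) = Metric.closedBall T' (1 / (r : ℝ)) := by
  ext S
  rw [mem_closedBall_iff hr, mem_closedBall_iff hr, h]

theorem ballVerts_height {T : PlaneTree} (hf : T.IsFinite) : T.ballVerts T.height = T.carrier := by
  ext u
  exact ⟨fun h => h.1, fun h => ⟨h, length_le_height hf h⟩⟩

instance : Countable {T : PlaneTree // T.IsFinite} := by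
  refine Function.Injective.countable (f := fun T : {T : PlaneTree // T.IsFinite} =>
    (show T.1.carrier.Finite from T.2).toFinset) fun T T' h => ?_
  refine Subtype.ext (PlaneTree.ext ?_)
  have h' := congrArg (fun s : Finset (List ℕ) => (s : Set (List ℕ))) h
  simpa using h'

/-- The maximal balls around finite trees, of radius the inverse height, inside a set. -/
def maximalBalls (U : Set PlaneTree) : Set PlaneTree :=
  {T₀ | T₀.IsFinite ∧ Metric.closedBall T₀ (1 / (T₀.height : ℝ)) ⊆ U ∧
    ∀ r : ℕ, 1 ≤ r → r < T₀.height → ¬ Metric.closedBall T₀ (1 / (r : ℝ)) ⊆ U}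

theorem maximalBalls_countable (U : Set PlaneTree) : (maximalBalls U).Countable :=
  (Set.countable_coe_iff.1 (inferInstanceAs (Countable {T : PlaneTree // T.IsFinite}))).mono
    (s₂ := {T : PlaneTree | T.IsFinite}) fun _ h => h.1

/-- The metric is an ultrametric: intersecting balls are nested, and a ball properly inside another
one contained in `U` is not maximal. -/
theorem maximalBalls_disjoint (U : Set PlaneTree) : Pairwise (Function.onFun Disjoint
    fun T₀ : maximalBalls U => Metric.closedBall T₀.1 (1 / (T₀.1.height : ℝ))) := by
  have key : ∀ T₀ ∈ maximalBalls U, ∀ T₁ ∈ maximalBalls U, T₀.height ≤ T₁.height →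
      ∀ T, T ∈ Metric.closedBall T₀ (1 / (T₀.height : ℝ)) →
        T ∈ Metric.closedBall T₁ (1 / (T₁.height : ℝ)) → T₀ = T₁ := by
    intro T₀ h₀ T₁ h₁ hle T hT₀ hT₁
    have hr := one_le_height h₀.1
    rw [mem_closedBall_iff (one_le_height h₀.1)] at hT₀
    rw [mem_closedBall_iff (one_le_height h₁.1)] at hT₁
    have h := hT₀.symm.trans (ballVerts_mono_eq hT₁ hle)
    rcases hle.eq_or_lt with he | hlt
    · refine PlaneTree.ext ?_
      rw [← ballVerts_height h₀.1, h, he, ballVerts_height h₁.1]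
    · exact absurd (closedBall_congr hr h ▸ h₀.2.1) (h₁.2.2 _ hr hlt)
  rintro ⟨T₀, h₀⟩ ⟨T₁, h₁⟩ hne
  refine Set.disjoint_left.2 fun T hT₀ hT₁ => hne (Subtype.ext ?_)
  rcases le_total T₀.height T₁.height with h | h
  · exact key T₀ h₀ T₁ h₁ h T hT₀ hT₁
  · exact (key T₁ h₁ T₀ h₀ h T hT₁ hT₀).symm

theorem exists_mem_maximalBalls {U : Set PlaneTree} (hU : IsOpen U) {T : PlaneTree}
    (hT : ¬ T.IsFinite) (hTU : T ∈ U) :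
    ∃ T₀ ∈ maximalBalls U, T ∈ Metric.closedBall T₀ (1 / (T₀.height : ℝ)) := by
  have hex : ∃ r : ℕ, 1 ≤ r ∧ Metric.closedBall T (1 / (r : ℝ)) ⊆ U := by
    obtain ⟨ε, hε, hεU⟩ := Metric.isOpen_iff.1 hU T hTU
    obtain ⟨n, hn⟩ := exists_nat_one_div_lt hε
    refine ⟨n + 1, by omega, (Metric.closedBall_subset_ball ?_).trans hεU⟩
    push_cast
    exact hn
  classical
  obtain ⟨hr, hrU⟩ := Nat.find_spec hex
  have hmin := fun s (h : s < Nat.find hex) => Nat.find_min hex h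
  generalize Nat.find hex = r at hr hrU hmin
  -- The centre is the truncation at the least `r` whose ball fits into `U`; minimality of `r` gives
  -- maximality of the ball.
  obtain ⟨T₀, hf, rfl, hb⟩ := exists_truncation hT hr
  refine ⟨T₀, ⟨hf, (closedBall_congr hr hb).trans_subset hrU, fun s hs hlt hsub => ?_⟩,
    (mem_closedBall_iff hr).2 hb.symm⟩
  exact hmin s hlt ⟨hs, (closedBall_congr hs (ballVerts_mono_eq hb hlt.le)) ▸ hsub⟩

/-- Stated for an arbitrary Kesten law, so that it yields both convergence and uniqueness. -/
theorem tendsto_finiteSizeLaw {μ k : ℝ} (hk1 : 1 < k) (hk : k = Real.exp (-μ))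
    {ν : ProbabilityMeasure PlaneTree} (hν : IsKestenLaw (branchingProb k) ν) :
    Tendsto (fun N : ℕ+ => finiteSizeLaw μ N) atTop (𝓝 ν) := by
  refine tendsto_of_forall_isOpen_le_liminf' fun U hU => ?_
  have : Countable (maximalBalls U) := (maximalBalls_countable U).to_subtype
  let B : maximalBalls U → Set PlaneTree :=
    fun T₀ => Metric.closedBall T₀.1 (1 / (T₀.1.height : ℝ))
  have hcover : (ν : Measure PlaneTree) U ≤ (ν : Measure PlaneTree) (⋃ T₀, B T₀) := by
    refine measure_mono_ae ?_
    filter_upwards [hν.ae_infinite] with T hT hTU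
    obtain ⟨T₀, h₀, hT₀⟩ := exists_mem_maximalBalls hU hT hTU
    exact Set.mem_iUnion.2 ⟨⟨T₀, h₀⟩, hT₀⟩
  calc (ν : Measure PlaneTree) U ≤ ∑' T₀, (ν : Measure PlaneTree) (B T₀) :=
        hcover.trans (measure_iUnion_le B)
    _ ≤ ∑' T₀, liminf (fun N : ℕ+ => finiteSizeMeasure μ N (B T₀)) atTop := by
        refine ENNReal.tsum_le_tsum fun T₀ => ?_
        rw [← ofReal_measureReal, hν.measure_ball T₀.1 T₀.2.1]
        exact ofReal_sum_markedWeight_le_liminf hk1 hk T₀.2.1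
    _ ≤ liminf (fun N : ℕ+ => ∑' T₀, finiteSizeMeasure μ N (B T₀)) atTop := by
        -- Fatou's lemma for the counting measure on the maximal balls.
        simp_rw [← lintegral_count]
        exact lintegral_liminf_le fun _ => measurable_of_countable _
    _ ≤ liminf (fun N : ℕ+ => (finiteSizeLaw μ N : Measure PlaneTree) U) atTop := by
        refine liminf_le_liminf (Eventually.of_forall fun N => ?_)
        rw [← measure_iUnion (maximalBalls_disjoint U)
          fun T₀ => Metric.isClosed_closedBall.measurableSet]
        exact measure_mono (Set.iUnion_subset fun T₀ => T₀.2.2.1)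

/-! ### Measurability -/

/-- Levels are finite, so the balls are cylinders fixed by a finite set of words and a height. There
are only countably many of these, and every open set is a union of them. -/
theorem measurable_of_measurableSet_mem {Ω : Type*} [MeasurableSpace Ω] {f : Ω → PlaneTree}
    (hf : ∀ w, MeasurableSet {x | w ∈ (f x).carrier}) : Measurable f := by
  refine measurable_of_isOpen fun U hU => ?_
  let C : Finset (List ℕ) × ℕ → Set PlaneTree := fun p =>
    {T | ∀ w : List ℕ, w.length ≤ p.2 → (w ∈ T.carrier ↔ w ∈ p.1)}
  have hC : ∀ p, MeasurableSet (f ⁻¹' C p) := by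
    intro p
    have : f ⁻¹' C p = ⋂ w : List ℕ, ⋂ _ : w.length ≤ p.2,
        {x | w ∈ (f x).carrier ↔ w ∈ p.1} := by
      ext x
      simp [C]
    rw [this]
    refine MeasurableSet.iInter fun w => MeasurableSet.iInter fun _ => ?_
    by_cases h : w ∈ p.1
    · simpa [h] using hf w
    · simp only [h, iff_false]
      exact (hf w).compl
  have hU' : f ⁻¹' U = ⋃ p : {p // C p ⊆ U}, f ⁻¹' C p := by
    ext x
    simp only [Set.mem_preimage, Set.mem_iUnion]
    constructor
    · intro hx
      obtain ⟨ε, hε, hεU⟩ := Metric.isOpen_iff.1 hU _ hx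
      obtain ⟨n, hn⟩ := exists_nat_one_div_lt hε
      have hfin : ((f x).ballVerts (n + 1)).Finite := by
        refine ((Finset.range (n + 2)).finite_toSet.biUnion
          fun s _ => (f x).level_finite s).subset fun u hu => ?_
        simp only [Set.mem_iUnion]
        exact ⟨u.length, by simpa [Nat.lt_succ_iff] using hu.2, hu.1, rfl⟩
      refine ⟨⟨⟨hfin.toFinset, n + 1⟩, fun T hT => hεU ?_⟩, ?_⟩
      · refine Metric.closedBall_subset_ball (ε₁ := 1 / ((n + 1 : ℕ) : ℝ)) (by push_cast; exact hn)
          ((mem_closedBall_iff (by omega)).2 ?_)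
        ext w
        have := hT w
        simp only [ballVerts, Set.mem_ofPred_eq, Set.Finite.mem_toFinset] at this ⊢
        constructor
        · intro h
          exact (this h.2).1 h.1
        · intro h
          exact ⟨(this h.2).2 h, h.2⟩
      · intro w hw
        have hw' : w.length ≤ n + 1 := hw
        simp [ballVerts, hw']
    · rintro ⟨⟨p, hp⟩, hx⟩
      exact hp hx
  rw [hU']
  exact MeasurableSet.iUnion fun p => hC p

theorem measurableSet_mem (w : List ℕ) : MeasurableSet {T : PlaneTree | w ∈ T.carrier} := by
  refine IsOpen.measurableSet (Metric.isOpen_iff.2 fun T hT => ?_)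
  refine ⟨1 / ((w.length + 1 : ℕ) : ℝ), by positivity, fun T' hT' => ?_⟩
  have := Set.ext_iff.1 (ballVerts_eq_of_dist_lt (by omega) hT') w
  simpa [ballVerts, show w ∈ T.carrier from hT] using this

theorem measurableSet_infinite {p : PlaneTree → List ℕ → Prop}
    (hp : ∀ w, MeasurableSet {T | p T w}) : MeasurableSet {T | {w | p T w}.Infinite} := by
  have : {T | {w | p T w}.Infinite} =
      ⋂ F : Finset (List ℕ), ⋃ w : List ℕ, ⋃ _ : w ∉ F, {T | p T w} := by
    ext T
    simp only [Set.mem_ofPred_eq, Set.mem_iInter, Set.mem_iUnion, exists_prop]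
    constructor
    · intro h F
      obtain ⟨w, hw, hwF⟩ := h.exists_notMem_finset F
      exact ⟨w, hwF, hw⟩
    · intro h hfin
      obtain ⟨w, hwF, hw⟩ := h hfin.toFinset
      exact hwF (hfin.mem_toFinset.2 hw)
  rw [this]
  exact MeasurableSet.iInter fun F => MeasurableSet.iUnion fun w => MeasurableSet.iUnion fun _ =>
    hp w

theorem measurableSet_isInfiniteType (u : List ℕ) :
    MeasurableSet {T : PlaneTree | T.IsInfiniteType u} :=
  measurableSet_infinite fun w => (measurableSet_mem w).inter (MeasurableSet.const _)

theorem measurableSet_hasSingleSpine : MeasurableSet {T : PlaneTree | T.HasSingleSpine} := by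
  have hA : ∀ r u, MeasurableSet {T : PlaneTree | u ∈ T.level r ∧ T.IsInfiniteType u} :=
    fun r u => ((measurableSet_mem u).inter (MeasurableSet.const _)).inter
      (measurableSet_isInfiniteType u)
  have : {T : PlaneTree | T.HasSingleSpine} = ⋂ r : ℕ, ⋃ u : List ℕ,
      {T : PlaneTree | u ∈ T.level r ∧ T.IsInfiniteType u} ∩
        ⋂ y : List ℕ, ⋂ _ : y ≠ u, {T : PlaneTree | y ∈ T.level r ∧ T.IsInfiniteType y}ᶜ := by
    ext T
    simp only [HasSingleSpine, ExistsUnique, Set.mem_ofPred_eq, Set.mem_iInter, Set.mem_iUnion,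
      Set.mem_inter_iff, Set.mem_compl_iff]
    refine forall_congr' fun r => exists_congr fun u => and_congr_right fun _ =>
      forall_congr' fun y => ?_
    exact not_imp_not.symm
  rw [this]
  exact MeasurableSet.iInter fun r => MeasurableSet.iUnion fun u => (hA r u).inter
    (MeasurableSet.iInter fun y => MeasurableSet.iInter fun _ => (hA r y).compl)

/-! ### Kesten's tree -/

/-- The special offspring of the special vertex `v`, which has `(ω v).1` left siblings. -/
def spineChild (ω : List ℕ → ℕ × ℕ) (v : List ℕ) : ℕ := if v = [] then 0 else (ω v).1

/-- The special vertex at height `n`. -/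
def spine (ω : List ℕ → ℕ × ℕ) : ℕ → List ℕ
  | 0 => []
  | n + 1 => spine ω n ++ [spineChild ω (spine ω n)]

open Classical in
/-- The offspring numbers in Kesten's tree: a normal vertex `v` has `(ω v).1` offspring, and a
special one has `(ω v).1` normal offspring to the left and `(ω v).2` to the right of its special
offspring. -/
def kestenOffspring (ω : List ℕ → ℕ × ℕ) (v : List ℕ) : ℕ :=
  if v = [] then 1 else if spine ω v.length = v then (ω v).1 + (ω v).2 + 1 else (ω v).1

/-- Kesten's tree as a function of the independent offspring variables. -/
def kestenTree (ω : List ℕ → ℕ × ℕ) : PlaneTree :=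
  ofOffspring (kestenOffspring ω) (by simp [kestenOffspring])

@[simp] theorem length_spine (ω : List ℕ → ℕ × ℕ) (n : ℕ) : (spine ω n).length = n := by
  induction n with
  | zero => rfl
  | succ n ih => simp [spine, ih]

theorem take_spine (ω : List ℕ → ℕ × ℕ) {n m : ℕ} (h : n ≤ m) :
    (spine ω m).take n = spine ω n := by
  induction m, h using Nat.le_induction with
  | base => exact List.take_of_length_le (by simp)
  | succ m h ih => rw [spine, List.take_append_of_le_length (by simpa using h), ih]

theorem spine_mem (ω : List ℕ → ℕ × ℕ) (n : ℕ) : spine ω n ∈ (kestenTree ω).carrier := by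
  induction n with
  | zero => exact (kestenTree ω).nil_mem
  | succ n ih =>
    rw [spine, kestenTree, mem_ofOffspring, inTree_append_singleton]
    refine ⟨ih, ?_⟩
    rw [spineChild, kestenOffspring, length_spine, if_pos rfl]
    split_ifs <;> omega

theorem not_isFinite_kestenTree (ω : List ℕ → ℕ × ℕ) : ¬ (kestenTree ω).IsFinite := by
  refine Set.infinite_of_injective_forall_mem (f := spine ω) (fun n m h => ?_) (spine_mem ω)
  simpa using congrArg List.length h

theorem measurableSet_spine_eq (n : ℕ) (u : List ℕ) : MeasurableSet {ω | spine ω n = u} := by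
  induction n generalizing u with
  | zero => exact MeasurableSet.const ([] = u)
  | succ n ih =>
    have : {ω | spine ω (n + 1) = u} = ⋃ v : List ℕ, {ω | spine ω n = v} ∩
        (fun ω : List ℕ → ℕ × ℕ => ω v) ⁻¹' {x | v ++ [if v = [] then 0 else x.1] = u} := by
      ext ω
      simp only [spine, spineChild, Set.mem_ofPred_eq, Set.mem_iUnion, Set.mem_inter_iff,
        Set.mem_preimage]
      constructor
      · intro h
        exact ⟨_, rfl, h⟩
      · rintro ⟨v, rfl, h⟩
        exact h
    rw [this]
    exact MeasurableSet.iUnion fun v => (ih v).inter (measurable_pi_apply v (.of_discrete))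

theorem measurable_kestenOffspring (v : List ℕ) :
    Measurable fun ω : List ℕ → ℕ × ℕ => kestenOffspring ω v := by
  have h1 : Measurable fun ω : List ℕ → ℕ × ℕ => (ω v).1 := measurable_fst.comp
    (measurable_pi_apply v)
  have h2 : Measurable fun ω : List ℕ → ℕ × ℕ => (ω v).2 := measurable_snd.comp
    (measurable_pi_apply v)
  classical
  by_cases hv : v = []
  · simp [kestenOffspring, hv]
  · simp only [kestenOffspring, if_neg hv]
    exact Measurable.ite (measurableSet_spine_eq _ _) ((h1.add h2).add_const 1) h1

theorem measurable_kestenTree : Measurable kestenTree := by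
  refine measurable_of_measurableSet_mem fun w => ?_
  simp only [kestenTree, mem_ofOffspring]
  induction w using List.reverseRecOn with
  | nil => simp
  | append_singleton w i ih =>
    simp only [inTree_append_singleton]
    exact ih.inter (measurable_kestenOffspring w (.of_discrete (s := {n | i < n})))

theorem ballVerts_ofOffspring_eq_iff {o : List ℕ → ℕ} {ho : o [] = 1} {T : PlaneTree} {r : ℕ} :
    (ofOffspring o ho).ballVerts r = T.ballVerts r ↔
      ∀ v ∈ T.carrier, v.length < r → o v = T.offspring v := by
  constructor
  · intro h v hv hvr
    rw [← (ballVerts_eq_iff _ _ _).1 h v hv hvr, offspring_ofOffspring]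
    have : v ∈ (ofOffspring o ho).ballVerts r := h ▸ ⟨hv, hvr.le⟩
    exact this.1
  · intro h
    refine (ballVerts_eq_iff _ _ _).2 fun v hv hvr => ?_
    rw [offspring_ofOffspring, h v hv hvr]
    refine inTree_congr (fun u hu hu' => ?_) ((mem_iff_inTree T v).1 hv)
    exact (h u ((mem_iff_inTree T u).2 hu') (hu.trans hvr)).symm

/-- The offspring variables for which the ball of radius `r` of Kesten's tree is that of `T₀` and
the special vertex at height `r` is `i`. -/
def markedBox (T₀ : PlaneTree) (i v : List ℕ) : Set (ℕ × ℕ) :=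
  if v <+: i then {x | v ++ [x.1] <+: i ∧ x.1 + x.2 + 1 = T₀.offspring v}
  else {x | x.1 = T₀.offspring v}

/-- The boxes force the spine to follow `i`. Hence boxes for different vertices `i` are disjoint,
which makes the mass of a ball a sum. -/
theorem spine_eq_of_mem_markedBox {T₀ : PlaneTree} {r : ℕ} {i : List ℕ}
    (hi : i ∈ T₀.levelFinset r) {ω : List ℕ → ℕ × ℕ}
    (hω : ω ∈ (T₀.innerVerts r : Set (List ℕ)).pi (markedBox T₀ i)) {n : ℕ} (hn : n ≤ r) :
    spine ω n = i.take n := by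
  rw [mem_levelFinset] at hi
  induction n with
  | zero => simp [spine]
  | succ n ih =>
    rw [spine, ih (by omega)]
    have hpre : i.take n <+: i := List.take_prefix n i
    have hl : (i.take n).length = n := by simp; omega
    have hlt : (i.take n).length < i.length := by omega
    have key : i.take n ++ [spineChild ω (i.take n)] <+: i := by
      -- The root carries no box; its only child is special by the convention in `spineChild`.
      by_cases h0 : n = 0
      · subst h0
        obtain ⟨j, hj⟩ := exists_append_singleton_prefix hpre hlt
        have := head_eq_zero (T₀.mem_of_prefix hj hi.1)
        subst this
        simpa [spineChild] using hj
      · have hne : i.take n ≠ [] := fun h => by simp [h] at hl; omega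
        have := hω (i.take n) (Finset.mem_coe.2
          (mem_innerVerts.2 ⟨T₀.mem_of_prefix hpre hi.1, by omega, by omega⟩))
        rw [markedBox, if_pos hpre] at this
        rw [spineChild, if_neg hne]
        exact this.1
    rw [List.prefix_iff_eq_take.1 key]
    simp [hl]

theorem kestenTree_ballVerts_eq_iff {T₀ : PlaneTree} {r : ℕ} {ω : List ℕ → ℕ × ℕ} :
    (kestenTree ω).ballVerts r = T₀.ballVerts r ↔ ∃ i ∈ T₀.levelFinset r,
      ω ∈ (T₀.innerVerts r : Set (List ℕ)).pi (markedBox T₀ i) := by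
  constructor
  · intro h
    have hi : spine ω r ∈ T₀.ballVerts r := h ▸ ⟨spine_mem ω r, by simp⟩
    refine ⟨spine ω r, mem_levelFinset.2 ⟨hi.1, by simp⟩, fun v hv => ?_⟩
    rw [Finset.mem_coe, mem_innerVerts] at hv
    have ho := ballVerts_ofOffspring_eq_iff.1 h v hv.1 hv.2.2
    have hne : v ≠ [] := by rintro rfl; simp at hv
    rw [kestenOffspring, if_neg hne] at ho
    rw [markedBox]
    split_ifs with hpre
    · have hv' : spine ω v.length = v := by
        rw [← take_spine ω hv.2.2.le]
        exact (List.prefix_iff_eq_take.1 hpre).symm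
      rw [if_pos hv'] at ho
      refine ⟨?_, ho⟩
      have h1 : spine ω (v.length + 1) = v ++ [(ω v).1] := by
        rw [spine, hv', spineChild, if_neg hne]
      rw [← h1, ← take_spine ω (show v.length + 1 ≤ r from hv.2.2)]
      exact List.take_prefix _ _
    · rwa [if_neg] at ho
      intro hv'
      refine hpre ?_
      rw [← hv', ← take_spine ω hv.2.2.le]
      exact List.take_prefix _ _
  · rintro ⟨i, hi, hω⟩
    refine ballVerts_ofOffspring_eq_iff.2 fun v hv hvr => ?_
    by_cases hne : v = []
    · subst hne
      rw [offspring_nil]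
      simp [kestenOffspring]
    · have hb := hω v (Finset.mem_coe.2
        (mem_innerVerts.2 ⟨hv, List.length_pos_of_ne_nil hne, hvr⟩))
      rw [kestenOffspring, if_neg hne, spine_eq_of_mem_markedBox hi hω hvr.le]
      rw [markedBox] at hb
      by_cases hpre : v <+: i
      · rw [if_pos hpre] at hb
        rw [if_pos (List.prefix_iff_eq_take.1 hpre).symm]
        exact hb.2
      · rw [if_neg hpre] at hb
        rw [if_neg fun h => hpre (List.prefix_iff_eq_take.2 h.symm)]
        exact hb

/-! ### The law of Kesten's tree -/

/-- The offspring law as a probability mass function. -/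
def offspringPMF {k : ℝ} (hk : 1 < k) : PMF ℕ :=
  ⟨fun n => ENNReal.ofReal (branchingProb k n), by
    rw [ENNReal.summable.hasSum_iff, ← ENNReal.ofReal_tsum_of_nonneg (branchingProb_nonneg hk)
      (hasSum_branchingProb hk).summable, (hasSum_branchingProb hk).tsum_eq, ENNReal.ofReal_one]⟩

theorem offspringPMF_apply {k : ℝ} (hk : 1 < k) (n : ℕ) :
    offspringPMF hk n = ENNReal.ofReal (branchingProb k n) := rfl

/-- The law of the pair of offspring variables at a vertex. -/
def siteLaw {k : ℝ} (hk : 1 < k) : Measure (ℕ × ℕ) :=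
  (offspringPMF hk).toMeasure.prod (offspringPMF hk).toMeasure

instance {k : ℝ} (hk : 1 < k) : IsProbabilityMeasure (siteLaw hk) := by
  rw [siteLaw]; infer_instance

/-- The law of the independent offspring variables. -/
def offspringLaw {k : ℝ} (hk : 1 < k) : Measure (List ℕ → ℕ × ℕ) :=
  Measure.infinitePi fun _ => siteLaw hk

instance {k : ℝ} (hk : 1 < k) : IsProbabilityMeasure (offspringLaw hk) := by
  rw [offspringLaw]; infer_instance

theorem siteLaw_fst {k : ℝ} (hk : 1 < k) (s : Set ℕ) :
    siteLaw hk {x | x.1 ∈ s} = (offspringPMF hk).toMeasure s := by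
  have : {x : ℕ × ℕ | x.1 ∈ s} = s ×ˢ Set.univ := by ext; simp
  rw [this, siteLaw, Measure.prod_prod, measure_univ, mul_one]

/-- Special to the geometric law: with $x=1/(1+k)$ and $1-x=kx$, the product
$p(a)p(b)=x^{a+b}(1-x)^2$ depends only on $a+b$ and equals $k\,p(a+b+1)$. So independent left and
right numbers realise $p^s$. -/
theorem siteLaw_singleton {k : ℝ} (hk : 1 < k) (a b : ℕ) :
    siteLaw hk {(a, b)} = ENNReal.ofReal (specialProb (branchingProb k) (a + b)) := by
  rw [← Set.singleton_prod_singleton, siteLaw, Measure.prod_prod,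
    PMF.toMeasure_apply_singleton _ _ (.of_discrete), PMF.toMeasure_apply_singleton _ _ (.of_discrete),
    offspringPMF_apply, offspringPMF_apply, ← ENNReal.ofReal_mul (branchingProb_nonneg hk _),
    specialProb_branchingProb hk, branchingProb_eq hk, branchingProb_eq hk, branchingProb_eq hk]
  congr 1
  have : 1 + k ≠ 0 := by linarith
  rw [show 1 - 1 / (1 + k) = k * (1 / (1 + k)) by field_simp; ring]
  ring

theorem siteLaw_markedBox {k : ℝ} (hk : 1 < k) {T₀ : PlaneTree} {r : ℕ} {i : List ℕ}
    (hi : i ∈ T₀.levelFinset r) {v : List ℕ} (hv : v ∈ T₀.innerVerts r) :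
    siteLaw hk (markedBox T₀ i v) = ENNReal.ofReal (if v <+: i then
      specialProb (branchingProb k) (T₀.offspring v - 1) else
      branchingProb k (T₀.offspring v)) := by
  rw [mem_innerVerts] at hv
  rw [mem_levelFinset] at hi
  rw [markedBox]
  split_ifs with hpre
  · obtain ⟨j, hj⟩ := exists_append_singleton_prefix hpre (by omega)
    have hlt := (append_singleton_mem_iff T₀ v j).1 (T₀.mem_of_prefix hj hi.1)
    -- The next letter of `i` fixes the number of left siblings and the offspring number fixes the
    -- right one, so the box is a single pair.
    have : {x : ℕ × ℕ | v ++ [x.1] <+: i ∧ x.1 + x.2 + 1 = T₀.offspring v} =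
        {(j, T₀.offspring v - 1 - j)} := by
      ext ⟨a, b⟩
      simp only [Set.mem_ofPred_eq, Set.mem_singleton_iff, Prod.mk.injEq]
      constructor
      · rintro ⟨h1, h2⟩
        have h3 := (List.prefix_of_prefix_length_le h1 hj (by simp)).eq_of_length (by simp)
        simp only [List.append_cancel_left_eq, List.cons.injEq, and_true] at h3
        exact ⟨h3, by omega⟩
      · rintro ⟨rfl, rfl⟩
        exact ⟨hj, by omega⟩
    rw [this, siteLaw_singleton, show j + (T₀.offspring v - 1 - j) = T₀.offspring v - 1 by omega]
  · have := siteLaw_fst hk {T₀.offspring v}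
    simp only [Set.mem_singleton_iff] at this
    rw [this, PMF.toMeasure_apply_singleton _ _ (.of_discrete), offspringPMF_apply]

theorem specialProb_nonneg {k : ℝ} (hk : 1 < k) (n : ℕ) : 0 ≤ specialProb (branchingProb k) n := by
  rw [specialProb_branchingProb hk]
  exact mul_nonneg (by linarith) (branchingProb_nonneg hk _)

theorem measurableSet_markedBox (T₀ : PlaneTree) (r : ℕ) (i : List ℕ) :
    MeasurableSet ((T₀.innerVerts r : Set (List ℕ)).pi (markedBox T₀ i)) :=
  MeasurableSet.pi (Finset.countable_toSet _) fun _ _ => .of_discrete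

theorem offspringLaw_markedBox {k : ℝ} (hk : 1 < k) {T₀ : PlaneTree} {i : List ℕ}
    (hi : i ∈ T₀.levelFinset T₀.height) :
    (offspringLaw hk).real ((T₀.innerVerts T₀.height : Set (List ℕ)).pi (markedBox T₀ i)) =
      markedWeight (branchingProb k) T₀ i := by
  rw [measureReal_def, offspringLaw, Measure.infinitePi_pi _ fun _ _ => .of_discrete,
    ENNReal.toReal_prod, markedWeight, mul_comm, ← Finset.prod_ite]
  refine Finset.prod_congr rfl fun v hv => ?_
  rw [siteLaw_markedBox hk hi hv, ENNReal.toReal_ofReal]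
  split_ifs
  exacts [specialProb_nonneg hk _, branchingProb_nonneg hk _]

/-- The law of Kesten's tree. -/
def kestenLaw {k : ℝ} (hk : 1 < k) : ProbabilityMeasure PlaneTree :=
  ⟨(offspringLaw hk).map kestenTree, Measure.isProbabilityMeasure_map
    measurable_kestenTree.aemeasurable⟩

theorem coe_kestenLaw {k : ℝ} (hk : 1 < k) :
    (kestenLaw hk : Measure PlaneTree) = (offspringLaw hk).map kestenTree := rfl

theorem measurableSet_isFinite : MeasurableSet {T : PlaneTree | T.IsFinite} := by
  have := (measurableSet_infinite (p := fun T w => w ∈ T.carrier) measurableSet_mem).compl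
  convert! this using 1
  ext T
  simp [IsFinite]

theorem isKestenLaw_kestenLaw {k : ℝ} (hk : 1 < k) :
    IsKestenLaw (branchingProb k) (kestenLaw hk) where
  ae_infinite := by
    rw [coe_kestenLaw]
    exact (ae_map_iff measurable_kestenTree.aemeasurable measurableSet_isFinite.compl).2
      (Eventually.of_forall not_isFinite_kestenTree)
  measure_ball T₀ hf := by
    have hset : kestenTree ⁻¹' Metric.closedBall T₀ (1 / (T₀.height : ℝ)) =
        ⋃ i ∈ T₀.levelFinset T₀.height,
          (T₀.innerVerts T₀.height : Set (List ℕ)).pi (markedBox T₀ i) := by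
      ext ω
      rw [Set.mem_preimage, mem_closedBall_iff (one_le_height hf), kestenTree_ballVerts_eq_iff]
      simp only [Set.mem_iUnion, exists_prop]
    rw [coe_kestenLaw, map_measureReal_apply measurable_kestenTree
      Metric.isClosed_closedBall.measurableSet, hset, measureReal_biUnion_finset]
    · exact Finset.sum_congr rfl fun i hi => offspringLaw_markedBox hk hi
    · intro i hi j hj hij
      refine Set.disjoint_left.2 fun ω hωi hωj => hij ?_
      have h1 := spine_eq_of_mem_markedBox hi hωi le_rfl
      have h2 := spine_eq_of_mem_markedBox hj hωj le_rfl
      rw [Finset.mem_coe, mem_levelFinset] at hi hj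
      rw [List.take_of_length_le hi.2.le] at h1
      rw [List.take_of_length_le hj.2.le] at h2
      exact h1.symm.trans h2
    · exact fun i _ => measurableSet_markedBox _ _ _

/-! ### The single spine -/

theorem tsum_fin_prod (h : ℕ → ENNReal) (n : ℕ) :
    ∑' f : Fin n → ℕ, ∏ i, h (f i) = (∑' j, h j) ^ n := by
  induction n with
  | zero => simp
  | succ n ih =>
    rw [← (Fin.consEquiv fun _ => ℕ).tsum_eq, ENNReal.tsum_prod']
    simp only [Fin.consEquiv_apply, Fin.prod_univ_succ, Fin.cons_zero, Fin.cons_succ,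
      ENNReal.tsum_mul_left]
    rw [ih, ENNReal.tsum_mul_right, pow_succ']

theorem tsum_list_prod (h : ℕ → ENNReal) :
    ∑' v : List ℕ, ∏ i : Fin v.length, h (v.get i) = ∑' n : ℕ, (∑' j, h j) ^ n := by
  rw [← (List.equivSigmaTuple (α := ℕ)).symm.tsum_eq]
  have : ∀ s : Σ n, Fin n → ℕ, ∏ i : Fin (List.equivSigmaTuple.symm s).length,
      h ((List.equivSigmaTuple.symm s).get i) = ∏ i, h (s.2 i) := by
    intro s
    have := congrArg (fun s : Σ n, Fin n → ℕ => ∏ i, h (s.2 i))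
      (List.equivSigmaTuple.apply_symm_apply s)
    exact this
  simp_rw [this]
  rw [ENNReal.tsum_sigma']
  simp_rw [tsum_fin_prod]

/-- The tail formula $\sum_j P(\xi>j)=E\,\xi$, obtained by exchanging sums. -/
theorem tsum_offspringPMF_tail {k : ℝ} (hk : 1 < k) :
    ∑' j : ℕ, (offspringPMF hk).toMeasure {n | j < n} = ENNReal.ofReal (1 / k) := by
  simp_rw [PMF.toMeasure_apply _ (.of_discrete (s := {n : ℕ | _ < n}))]
  rw [ENNReal.tsum_comm]
  have h1 : ∀ n : ℕ, ∑' j : ℕ, {n | j < n}.indicator (offspringPMF hk) n =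
      ENNReal.ofReal (n * branchingProb k n) := by
    intro n
    rw [tsum_eq_sum (s := Finset.range n)]
    · rw [Finset.sum_congr rfl (g := fun _ => offspringPMF hk n) fun j hj =>
        Set.indicator_of_mem (s := {n | j < n}) (Finset.mem_range.1 hj) _, Finset.sum_const, Finset.card_range, nsmul_eq_mul, offspringPMF_apply,
        ENNReal.ofReal_mul (Nat.cast_nonneg n), ENNReal.ofReal_natCast]
    · intro j hj
      exact Set.indicator_of_notMem (fun h => hj (Finset.mem_range.2 h)) _
  simp_rw [h1]
  rw [← ENNReal.ofReal_tsum_of_nonneg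
    (fun n => mul_nonneg (Nat.cast_nonneg n) (branchingProb_nonneg hk n))
    (hasSum_mean_branchingProb hk).summable, (hasSum_mean_branchingProb hk).tsum_eq]

theorem inTree_iff_get (o : List ℕ → ℕ) (v : List ℕ) :
    InTree o v ↔ ∀ i : Fin v.length, v.get i < o (v.take i) := by
  induction v generalizing o with
  | nil => simp
  | cons j v ih =>
    rw [inTree_cons, ih]
    simp [Fin.forall_fin_succ]

/-- Membership of `v` constrains the variables at its proper prefixes only; these are distinct
sites, so the conditions are independent. -/
theorem offspringLaw_inTree {k : ℝ} (hk : 1 < k) (u v : List ℕ) :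
    offspringLaw hk {ω | InTree (fun x => (ω (u ++ x)).1) v} =
      ∏ i : Fin v.length, (offspringPMF hk).toMeasure {n | v.get i < n} := by
  have hinj : Function.Injective fun i : Fin v.length => u ++ v.take i := by
    intro a b h
    have := congrArg List.length h
    simp at this
    omega
  -- The condition is attached to the site `y` rather than to the index, as a product set requires;
  -- injectivity leaves one index per site.
  let t : List ℕ → Set (ℕ × ℕ) := fun y => {x | ∀ i : Fin v.length, u ++ v.take i = y →
    v.get i < x.1}
  have ht : ∀ i : Fin v.length, t (u ++ v.take i) = {x | x.1 ∈ {n | v.get i < n}} := by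
    intro i
    ext x
    constructor
    · intro h
      exact h i rfl
    · intro h j hj
      obtain rfl := hinj hj
      exact h
  have hset : {ω : List ℕ → ℕ × ℕ | InTree (fun x => (ω (u ++ x)).1) v} =
      ((Finset.univ.map ⟨_, hinj⟩ : Finset (List ℕ)) : Set (List ℕ)).pi t := by
    ext ω
    simp only [Set.mem_ofPred_eq, inTree_iff_get, Set.mem_pi, Finset.coe_map,
      Function.Embedding.coeFn_mk, Finset.coe_univ, Set.image_univ, Set.forall_mem_range]
    refine forall_congr' fun i => ?_
    rw [ht]
    rfl
  rw [hset, offspringLaw, Measure.infinitePi_pi _ fun _ _ => .of_discrete, Finset.prod_map]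
  exact Finset.prod_congr rfl fun i _ => by
    rw [Function.Embedding.coeFn_mk, ht, siteLaw_fst]

/-- The expected number of vertices is $\sum_n m^n$ with $m=1/k<1$, so Borel–Cantelli applies. All
vertices are treated as normal here, which is correct for branches off the spine. -/
theorem ae_finite_normal_branch {k : ℝ} (hk : 1 < k) (u : List ℕ) :
    ∀ᵐ ω ∂offspringLaw hk, {v | InTree (fun x => (ω (u ++ x)).1) v}.Finite := by
  refine ae_finite_setOfPred_mem (s := fun v =>
    {ω : List ℕ → ℕ × ℕ | InTree (fun x => (ω (u ++ x)).1) v}) ?_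
  simp_rw [offspringLaw_inTree]
  rw [tsum_list_prod fun j => (offspringPMF hk).toMeasure {n | j < n}, tsum_offspringPMF_tail,
    ENNReal.tsum_geometric]
  refine ENNReal.inv_ne_top.2 (tsub_pos_of_lt ?_).ne'
  rw [ENNReal.ofReal_lt_one, div_lt_one] <;> linarith

theorem hasSingleSpine_kestenTree {ω : List ℕ → ℕ × ℕ}
    (hω : ∀ u, {v | InTree (fun x => (ω (u ++ x)).1) v}.Finite) :
    (kestenTree ω).HasSingleSpine := by
  intro r
  refine ⟨spine ω r, ⟨⟨spine_mem ω r, length_spine ω r⟩, ?_⟩, ?_⟩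
  · refine Set.infinite_of_injective_forall_mem (f := fun n => spine ω (r + n))
      (fun n m h => ?_) fun n => ⟨spine_mem ω _, ?_⟩
    · simpa using congrArg List.length h
    · rw [← take_spine ω (Nat.le_add_right r n)]
      exact List.take_prefix _ _
  · rintro y ⟨⟨hy, rfl⟩, hinf⟩
    by_contra hne
    -- Prefixes of spine vertices lie on the spine, so above an off-spine vertex `y` every vertex is
    -- normal.
    have hoff : ∀ x, kestenOffspring ω (y ++ x) = (ω (y ++ x)).1 := by
      intro x
      rw [kestenOffspring, if_neg, if_neg]
      · intro h
        refine hne ?_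
        rw [← take_spine ω (show y.length ≤ (y ++ x).length by simp), h]
        simp
      · intro h
        rw [(List.append_eq_nil_iff.1 h).1] at hne
        exact hne rfl
    refine hinf (((hω y).image (fun v => y ++ v)).subset ?_)
    rintro w ⟨hw, v, rfl⟩
    refine ⟨v, ?_, rfl⟩
    have := ((inTree_append _ _ _).1 (mem_ofOffspring.1 hw)).2
    simp only [hoff] at this
    exact this

theorem ae_hasSingleSpine_kestenLaw {k : ℝ} (hk : 1 < k) :
    ∀ᵐ T ∂(kestenLaw hk : Measure PlaneTree), T.HasSingleSpine := by
  rw [coe_kestenLaw, ae_map_iff measurable_kestenTree.aemeasurable measurableSet_hasSingleSpine]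
  filter_upwards [ae_all_iff.2 fun u => ae_finite_normal_branch hk u] with ω hω
  exact hasSingleSpine_kestenTree hω

end PlaneTree

end

theorem mainTheorem9 (μ k : ℝ) (hμ : μ < 0) (hk : k = Real.exp (-μ)) :
    (Summable fun T : {T : PlaneTree // T.IsFinite} =>
      PlaneTree.criticalPoint k ^ T.1.size) ∧
    PlaneTree.IsSubcritical (PlaneTree.branchingProb k) ∧
    ∃ ν : ProbabilityMeasure PlaneTree,
      Tendsto (fun N : ℕ+ => PlaneTree.finiteSizeLaw μ N) atTop (𝓝 ν) ∧
      PlaneTree.IsKestenLaw (PlaneTree.branchingProb k) ν ∧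
      (∀ ν' : ProbabilityMeasure PlaneTree,
        PlaneTree.IsKestenLaw (PlaneTree.branchingProb k) ν' → ν' = ν) ∧
      ∀ᵐ T ∂(ν : Measure PlaneTree), T.HasSingleSpine := by
  have hk1 : 1 < k := by
    rw [hk, Real.one_lt_exp_iff]
    linarith
  have h := PlaneTree.isKestenLaw_kestenLaw hk1
  exact ⟨PlaneTree.summable_criticalPoint (by linarith),
    PlaneTree.isSubcritical_branchingProb hk1, PlaneTree.kestenLaw hk1,
    PlaneTree.tendsto_finiteSizeLaw hk1 hk h, h,
    -- Every Kesten law for this `p` is a weak limit of the same sequence, hence equal to the one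
    -- constructed.
    fun ν' h' => tendsto_nhds_unique (PlaneTree.tendsto_finiteSizeLaw hk1 hk h')
      (PlaneTree.tendsto_finiteSizeLaw hk1 hk h),
    PlaneTree.ae_hasSingleSpine_kestenLaw hk1⟩
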